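/- Let $\mathbb D$ be the open unit disk in $\mathbb C$, $dA$ area measure on $\mathbb D$, and fix $R\in(0,1)$. For $z\in\mathbb D$ let $D_z=\{w\in\mathbb D: |z-w|/|1-\bar wz|<R\}$ be the pseudohyperbolic disk with center $z$ and radius $R$, and let $|D_z|$ be its area. For $0<p<\infty$, $1\le q<\infty$ and a measurable function $f:\mathbb D\to\mathbb C$ put $$m_q(f,z)=\Bigl(\frac1{|D_z|}\int_{D_z}|f(w)|^q\,dA(w)\Bigr)^{1/q},\qquad \|f\|_{p,q}=\Bigl(\int_{\mathbb D}m_q(f,z)^p\,dA(z)\Bigr)^{1/p},$$ and let $L^p_q$ be the space of all measurable $f$ on $\mathbb D$ with $\|f\|_{p,q}<\infty$. Let $0<p<1$ and $q\ge 1$, and let $a,b$ be real numbers with $$a>-\frac1p,\qquad b>\frac2p-\frac1q-1,\qquad a+b+2>\frac qp.$$ Then each of the kernels $$K(z,w)=\frac{(1-|z|^2)^a(1-|w|^2)^b}{|1-\bar wz|^{a+b+2}},\qquad B(z,w)=\frac{(1-|z|^2)^a(1-|w|^2)^b}{|z-w|\,|1-\bar wz|^{a+b+1}}$$ defines a bounded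 operator on $L^p_q$ by integration with respect to $w$. That is, if $T$ denotes either kernel, then there is a constant $C$ such that for every $f\in L^p_q$ the integral $Tf(z)=\int_{\mathbb D}T(z,w)f(w)\,dA(w)$ converges absolutely for almost every $z\in\mathbb D$, the function $Tf$ belongs to $L^p_q$, and $\|Tf\|_{p,q}\le C\|f\|_{p,q}$. -/

import Mathlib

open MeasureTheory

noncomputable section

namespace BergmanLocalMeans

/-- The open unit disk in the complex plane. -/
def disk : Set ℂ := Metric.ball 0 1

/-- Area measure on the unit disk. -/
def area : Measure ℂ := volume.restrict disk

/-- The pseudohyperbolic distance between two points of the unit disk. -/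
def pseudoDist (z w : ℂ) : ℝ := ‖(z - w) / (1 - star w * z)‖

/-- The pseudohyperbolic disk with center `z` and pseudohyperbolic radius `R`. -/
def pseudoDisk (R : ℝ) (z : ℂ) : Set ℂ := {w | w ∈ disk ∧ pseudoDist z w < R}

/-- The local mean of order `q` of `f` at `z`, over the pseudohyperbolic disk of radius `R`.
It is `∞` when `|f| ^ q` is not integrable over that disk. -/
def localMean (R q : ℝ) (f : ℂ → ℂ) (z : ℂ) : ENNReal :=
  ((area (pseudoDisk R z))⁻¹ * ∫⁻ w in pseudoDisk R z, ‖f w‖ₑ ^ q ∂area) ^ (1 / q)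

/-- The (quasi-)norm of `L^p_q`: the `L^p` norm of the local mean of order `q`. -/
def lpqNorm (R p q : ℝ) (f : ℂ → ℂ) : ENNReal :=
  (∫⁻ z, localMean R q f z ^ p ∂area) ^ (1 / p)

/-- Membership in `L^p_q`. A function on the disk is represented by a function on `ℂ`, of which
only the values in the disk are used. -/
def MemLpq (R p q : ℝ) (f : ℂ → ℂ) : Prop :=
  AEMeasurable f area ∧ lpqNorm R p q f < ⊤

/-- The integral operator with kernel `K`, integration with respect to the second variable. -/
def integralOp (K : ℂ → ℂ → ℝ) (f : ℂ → ℂ) (z : ℂ) : ℂ :=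
  ∫ w, (K z w : ℂ) * f w ∂area

/-- The kernel `K` defines a bounded operator on `L^p_q`: for every `f` in the space the defining
integral converges absolutely at almost every point of the disk, the resulting function is again
in the space, and its norm is at most a constant (independent of `f`) times the norm of `f`. -/
def DefinesBoundedOperator (R p q : ℝ) (K : ℂ → ℂ → ℝ) : Prop :=
  ∃ C : NNReal, ∀ f : ℂ → ℂ, MemLpq R p q f →
    (∀ᵐ z ∂area, Integrable (fun w => (K z w : ℂ) * f w) area) ∧
    MemLpq R p q (integralOp K f) ∧
    lpqNorm R p q (integralOp K f) ≤ (C : ENNReal) * lpqNorm R p q f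

/-- The kernel `(1 - |z|²)^a (1 - |w|²)^b / |1 - w̄ z|^(a + b + 2)`. -/
def kernelK (a b : ℝ) (z w : ℂ) : ℝ :=
  (1 - ‖z‖ ^ 2) ^ a * (1 - ‖w‖ ^ 2) ^ b / ‖1 - star w * z‖ ^ (a + b + 2)

/-- The kernel `(1 - |z|²)^a (1 - |w|²)^b / (|z - w| |1 - w̄ z|^(a + b + 1))`. -/
def kernelB (a b : ℝ) (z w : ℂ) : ℝ :=
  (1 - ‖z‖ ^ 2) ^ a * (1 - ‖w‖ ^ 2) ^ b / (‖z - w‖ * ‖1 - star w * z‖ ^ (a + b + 1))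

end BergmanLocalMeans

end

/-!
The kernels are studied on functions with values in `[0, ∞]`. Write `d(z) = 1 - |z|²`, let `dλ` be
the invariant measure `d⁻² dA`, and let `D(z, r)` be the pseudohyperbolic disk.

*Change of scale.* The quantities `d(z)` and `|1 - w̄ z|` are constant up to a factor on
pseudohyperbolic disks of fixed radius, and `λ(D(z, r))` is bounded below. Hence `∫ F dA` is at most
a constant times `∫ (∫_{D(u, r)} F dA) dλ(u)` (`exists_lintegral_le_lintegral_setLIntegral`), and
`∫ K(z, w) F(w) dA(w)` is controlled by the integral of `g(u) = K(z, u) ∫_{D(u, r)} F dA` against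
`λ`.

*The exponent `p ≤ 1`.* On each small disk `g` is dominated by the analogous function `g'` with a
larger disk, so `g ^ p` is bounded by `∫ g' ^ p dλ`. Writing `g = g ^ (1 - p) * g ^ p` gives
`(∫ g dλ) ^ p ≤ C ∫ g' ^ p dλ` (`mul_rpow_lintegral_le`); this replaces the embedding of `ℓ^p` into
`ℓ^1` along a lattice. Integrating in `z` and using the Forelli–Rudin estimate
(`lintegral_defect_rpow_le`), where `a p > -1` and `(b + 2) p > 2` are needed, one finds that the
`L^p` norm of `K F` is bounded by that of the averages of `F` (`exists_lintegral_opK_rpow_le`).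

*The kernel `K`.* The function `K F` is constant up to a factor on pseudohyperbolic disks, so its
local means of order `q` are comparable to `K F` itself, while averages of `F` are at most its local
means of order `q`.

*The kernel `B`.* Away from the diagonal `B` is dominated by `K`. Near the diagonal it is of the
size of `1 / (d(z) |z - w|)`, whose marginals are bounded, so by Jensen's inequality the averages of
the `q`-th power of this part are bounded by averages of `F ^ q` over a somewhat larger
neighbourhood. These are dominated by an operator of type `K` with other parameters, applied to
`F ^ q` (`exists_average_nearKernel_rpow_le`), and the estimate for `K` is used once more with the
exponent `p / q`.
-/

namespace BergmanLocalMeans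

/-- The defect `1 - |z|²`, which is comparable to the distance from `z` to the unit circle. -/
noncomputable def defect (z : ℂ) : ℝ := 1 - ‖z‖ ^ 2

/-- Two positive reals are comparable with constant `M`: each is at most `M` times the other. -/
structure Comparable (M x y : ℝ) : Prop where
  left_pos : 0 < x
  right_pos : 0 < y
  le_right : x ≤ M * y
  le_left : y ≤ M * x

namespace Comparable

variable {M N x y z : ℝ}

lemma symm (h : Comparable M x y) : Comparable M y x :=
  ⟨h.right_pos, h.left_pos, h.le_left, h.le_right⟩

lemma const_pos (h : Comparable M x y) : 0 < M :=
  pos_of_mul_pos_left (h.left_pos.trans_le h.le_right) h.right_pos.le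

lemma trans (h : Comparable M x y) (h' : Comparable N y z) : Comparable (M * N) x z where
  left_pos := h.left_pos
  right_pos := h'.right_pos
  le_right := by
    calc x ≤ M * y := h.le_right
      _ ≤ M * (N * z) := by gcongr; exacts [h.const_pos.le, h'.le_right]
      _ = _ := by ring
  le_left := by
    calc z ≤ N * y := h'.le_left
      _ ≤ N * (M * x) := by gcongr; exacts [h'.const_pos.le, h.le_left]
      _ = _ := by ring

/-- Powers of comparable numbers are comparable, with a constant depending on the exponent only,
whatever the sign of the exponent. -/
lemma rpow_le (h : Comparable M x y) (s : ℝ) : x ^ s ≤ M ^ |s| * y ^ s := by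
  have hM := h.const_pos
  rcases le_total 0 s with hs | hs
  · rw [abs_of_nonneg hs, ← Real.mul_rpow hM.le h.right_pos.le]
    exact Real.rpow_le_rpow h.left_pos.le h.le_right hs
  · rw [abs_of_nonpos hs, Real.rpow_neg hM.le, ← Real.inv_rpow hM.le,
      ← Real.mul_rpow (inv_nonneg.2 hM.le) h.right_pos.le]
    refine Real.rpow_le_rpow_of_nonpos (by have := h.right_pos; positivity) ?_ hs
    rw [inv_mul_le_iff₀ hM]
    exact h.le_left

end Comparable

/-! ### The pseudohyperbolic geometry of the disk -/

lemma mem_disk {z : ℂ} : z ∈ disk ↔ ‖z‖ < 1 := by simp [disk]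

lemma measurableSet_disk : MeasurableSet disk := Metric.isOpen_ball.measurableSet

lemma defect_pos {z : ℂ} (hz : z ∈ disk) : 0 < defect z := by
  rw [mem_disk] at hz
  have := norm_nonneg z
  unfold defect; nlinarith

lemma norm_one_sub_star_mul_comm (z w : ℂ) : ‖1 - star w * z‖ = ‖1 - star z * w‖ := by
  rw [← norm_star (1 - star w * z)]
  simp [mul_comm]

lemma norm_one_sub_star_mul_self {z : ℂ} (hz : z ∈ disk) : ‖1 - star z * z‖ = defect z := by
  have h : 1 - star z * z = ((defect z : ℝ) : ℂ) := by
    rw [Complex.star_def, Complex.conj_mul']; simp [defect]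
  rw [h, Complex.norm_real, Real.norm_of_nonneg (defect_pos hz).le]

lemma one_sub_norm_le {z w : ℂ} (hw : w ∈ disk) : 1 - ‖z‖ ≤ ‖1 - star w * z‖ := by
  rw [mem_disk] at hw
  have h := norm_sub_norm_le (1 : ℂ) (star w * z)
  rw [norm_one, norm_mul, norm_star] at h
  nlinarith [norm_nonneg z]

lemma norm_one_sub_star_mul_pos {z w : ℂ} (hz : z ∈ disk) (hw : w ∈ disk) :
    0 < ‖1 - star w * z‖ := by
  have := one_sub_norm_le (z := z) hw
  rw [mem_disk] at hz
  linarith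

lemma defect_le_two_mul_norm {z w : ℂ} (hz : z ∈ disk) (hw : w ∈ disk) :
    defect z ≤ 2 * ‖1 - star w * z‖ := by
  have := one_sub_norm_le (z := z) hw
  rw [mem_disk] at hz
  have := norm_nonneg z
  unfold defect; nlinarith

lemma pseudoDist_comm (z w : ℂ) : pseudoDist z w = pseudoDist w z := by
  simp only [pseudoDist, norm_div, norm_one_sub_star_mul_comm z w, norm_sub_rev z w]

lemma pseudoDist_lt_iff {z w : ℂ} {r : ℝ} (hz : z ∈ disk) (hw : w ∈ disk) :
    pseudoDist z w < r ↔ ‖z - w‖ < r * ‖1 - star w * z‖ := by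
  rw [pseudoDist, norm_div, div_lt_iff₀ (norm_one_sub_star_mul_pos hz hw)]

lemma norm_one_sub_le_defect {z w : ℂ} {r : ℝ} (hr : r < 1) (hz : z ∈ disk) (hw : w ∈ disk)
    (h : pseudoDist z w < r) : ‖1 - star w * z‖ ≤ defect w / (1 - r) := by
  rw [pseudoDist_lt_iff hz hw] at h
  rw [le_div_iff₀ (by linarith)]
  have h1 : 1 - star w * z = (1 - star w * w) - star w * (z - w) := by ring
  have h2 := norm_sub_le (1 - star w * w) (star w * (z - w))
  rw [← h1, norm_one_sub_star_mul_self hw, norm_mul, norm_star] at h2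
  rw [mem_disk] at hw
  nlinarith [norm_nonneg (z - w)]

/-- If `z` and `w` are pseudohyperbolically close, then `|1 - v̄ z|` and `|1 - v̄ w|` are
comparable, uniformly in `v`. -/
lemma comparable_norm {z w v : ℂ} {r : ℝ} (hr : r < 1) (hz : z ∈ disk) (hw : w ∈ disk)
    (hv : v ∈ disk) (h : pseudoDist z w < r) :
    Comparable (2 / (1 - r)) ‖1 - star v * z‖ ‖1 - star v * w‖ := by
  have key : ∀ {z w : ℂ}, z ∈ disk → w ∈ disk → pseudoDist z w < r →
      ‖1 - star v * z‖ ≤ 2 / (1 - r) * ‖1 - star v * w‖ := by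
    intro z w hz hw h
    have h0 := norm_one_sub_le_defect hr hz hw h
    have h1 := defect_le_two_mul_norm hw hv
    rw [pseudoDist_lt_iff hz hw] at h
    have h2 : 1 - star v * z = (1 - star v * w) - star v * (z - w) := by ring
    have h3 := norm_sub_le (1 - star v * w) (star v * (z - w))
    rw [← h2, norm_mul, norm_star] at h3
    have hv' := mem_disk.1 hv
    have hr' : 0 < 1 - r := by linarith
    rw [le_div_iff₀ hr'] at h0
    rw [div_mul_eq_mul_div, le_div_iff₀ hr']
    have hr0 : 0 < r :=
      pos_of_mul_pos_left ((norm_nonneg _).trans_lt h) (norm_nonneg _)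
    have h4 : ‖v‖ * ‖z - w‖ ≤ r * ‖1 - star w * z‖ := by
      nlinarith [norm_nonneg (z - w)]
    have h5 : r * (‖1 - star w * z‖ * (1 - r)) ≤ r * (2 * ‖1 - star v * w‖) :=
      mul_le_mul_of_nonneg_left (h0.trans h1) hr0.le
    have h6 := norm_nonneg (1 - star v * w)
    nlinarith
  exact ⟨norm_one_sub_star_mul_pos hz hv, norm_one_sub_star_mul_pos hw hv, key hz hw h,
    key hw hz (by rwa [pseudoDist_comm])⟩

lemma comparable_norm' {z w v : ℂ} {r : ℝ} (hr : r < 1) (hz : z ∈ disk) (hw : w ∈ disk)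
    (hv : v ∈ disk) (h : pseudoDist z w < r) :
    Comparable (2 / (1 - r)) ‖1 - star z * v‖ ‖1 - star w * v‖ := by
  rw [norm_one_sub_star_mul_comm v z, norm_one_sub_star_mul_comm v w]
  exact comparable_norm hr hz hw hv h

lemma comparable_norm_defect {z w : ℂ} {r : ℝ} (hr : r < 1) (hz : z ∈ disk) (hw : w ∈ disk)
    (h : pseudoDist z w < r) : Comparable (2 / (1 - r)) ‖1 - star w * z‖ (defect z) := by
  rw [← norm_one_sub_star_mul_self hz]
  refine (comparable_norm' hr hz hw hz h).symm

lemma comparable_defect {z w : ℂ} {r : ℝ} (hr : r < 1) (hz : z ∈ disk) (hw : w ∈ disk)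
    (h : pseudoDist z w < r) : Comparable (2 / (1 - r)) (defect z) (defect w) := by
  have key : ∀ {z w : ℂ}, z ∈ disk → w ∈ disk → pseudoDist z w < r →
      defect z ≤ 2 / (1 - r) * defect w := by
    intro z w hz hw h
    have h0 := norm_one_sub_le_defect hr hz hw h
    have h1 := defect_le_two_mul_norm hz hw
    calc defect z ≤ 2 * (defect w / (1 - r)) := by linarith
      _ = _ := by ring
  exact ⟨defect_pos hz, defect_pos hw, key hz hw h, key hw hz (by rwa [pseudoDist_comm])⟩

/-- A substitute for the triangle inequality of the pseudohyperbolic distance. -/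
lemma pseudoDist_lt_of_lt_div_eight {u v w : ℂ} {R : ℝ} (hR : R < 1) (hu : u ∈ disk)
    (hv : v ∈ disk) (hw : w ∈ disk) (huw : pseudoDist u w < R / 8)
    (huv : pseudoDist u v < R / 8) : pseudoDist v w < R := by
  have hR0 : 0 < R / 8 := (norm_nonneg _).trans_lt huv
  have hM : 2 / (1 - R / 8) ≤ 4 := by
    rw [div_le_iff₀ (by linarith)]; linarith
  have h1 := (comparable_norm' (by linarith) hu hw hv huw).le_right
  have h2 := (comparable_norm (by linarith) hu hv hw huv).le_right
  rw [pseudoDist_lt_iff hu hw] at huw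
  rw [pseudoDist_lt_iff hu hv, norm_one_sub_star_mul_comm] at huv
  rw [pseudoDist_lt_iff hv hw]
  have h3 : ‖v - w‖ ≤ ‖u - v‖ + ‖u - w‖ := by
    rw [norm_sub_rev u v]
    calc ‖v - w‖ = ‖(v - u) + (u - w)‖ := by congr 1; ring
      _ ≤ _ := norm_add_le _ _
  have h4 : 2 / (1 - R / 8) * ‖1 - star w * v‖ ≤ 4 * ‖1 - star w * v‖ := by gcongr
  nlinarith [norm_nonneg (1 - star w * v)]

lemma pseudoDisk_subset_disk (r : ℝ) (z : ℂ) : pseudoDisk r z ⊆ disk := fun _ h => h.1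

lemma pseudoDisk_subset_ball {z : ℂ} {r : ℝ} (hr0 : 0 < r) (hr : r < 1) (hz : z ∈ disk) :
    pseudoDisk r z ⊆ Metric.ball z (defect z / (1 - r)) := by
  rintro w ⟨hw, h⟩
  have h0 := norm_one_sub_le_defect hr hw hz (by rwa [pseudoDist_comm])
  rw [pseudoDist_lt_iff hz hw] at h
  rw [norm_one_sub_star_mul_comm] at h0
  rw [mem_ball_iff_norm, norm_sub_rev]
  have : 0 < ‖1 - star w * z‖ := norm_one_sub_star_mul_pos hz hw
  nlinarith

lemma ball_subset_pseudoDisk {z : ℂ} {r : ℝ} (hr0 : 0 < r) (hr : r < 1) (hz : z ∈ disk) :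
    Metric.ball z (r / 2 * defect z) ⊆ pseudoDisk r z := by
  intro w h
  rw [mem_ball_iff_norm, norm_sub_rev] at h
  have hz' := mem_disk.1 hz
  have hd : defect z ≤ 2 * (1 - ‖z‖) := by unfold defect; nlinarith [norm_nonneg z]
  have hd0 := defect_pos hz
  have hw : w ∈ disk := by
    rw [mem_disk]
    have := norm_sub_norm_le w z
    rw [norm_sub_rev] at this
    nlinarith
  refine ⟨hw, (pseudoDist_lt_iff hz hw).2 ?_⟩
  have := defect_le_two_mul_norm hz hw
  nlinarith

lemma measurable_pseudoDist : Measurable (fun x : ℂ × ℂ => pseudoDist x.1 x.2) := by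
  unfold pseudoDist
  have : Measurable (fun x : ℂ × ℂ => star x.2) := continuous_star.measurable.comp measurable_snd
  fun_prop

lemma measurableSet_pseudoDisk_prod (r : ℝ) :
    MeasurableSet {x : ℂ × ℂ | x.2 ∈ pseudoDisk r x.1} :=
  (measurable_snd measurableSet_disk).inter
    (measurableSet_lt measurable_pseudoDist measurable_const)

lemma measurableSet_pseudoDisk (r : ℝ) (z : ℂ) : MeasurableSet (pseudoDisk r z) :=
  measurable_prodMk_left (measurableSet_pseudoDisk_prod r)

lemma mem_pseudoDisk_comm {r : ℝ} {z w : ℂ} (hz : z ∈ disk) (hw : w ∈ disk) :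
    w ∈ pseudoDisk r z ↔ z ∈ pseudoDisk r w := by
  simp [pseudoDisk, hz, hw, pseudoDist_comm z w]

lemma area_pseudoDisk (r : ℝ) (z : ℂ) : area (pseudoDisk r z) = volume (pseudoDisk r z) := by
  rw [area, Measure.restrict_apply (measurableSet_pseudoDisk r z),
    Set.inter_eq_left.2 (pseudoDisk_subset_disk r z)]

lemma ae_mem_disk : ∀ᵐ z ∂area, z ∈ disk := ae_restrict_mem measurableSet_disk

lemma volume_ball_ofReal {z : ℂ} {t : ℝ} (ht : 0 ≤ t) :
    volume (Metric.ball z t) = ENNReal.ofReal (Real.pi * t ^ 2) := by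
  rw [Complex.volume_ball, ← ENNReal.ofReal_pow ht, mul_comm, ENNReal.ofReal_mul Real.pi_pos.le]
  congr 1
  rw [ENNReal.ofReal, Real.toNNReal_of_nonneg Real.pi_pos.le]; rfl

lemma area_pseudoDisk_le {z : ℂ} {r : ℝ} (hr0 : 0 < r) (hr : r < 1) (hz : z ∈ disk) :
    area (pseudoDisk r z) ≤ ENNReal.ofReal (Real.pi / (1 - r) ^ 2 * defect z ^ 2) := by
  rw [area_pseudoDisk]
  refine (measure_mono (pseudoDisk_subset_ball hr0 hr hz)).trans ?_
  rw [volume_ball_ofReal (div_nonneg (defect_pos hz).le (by linarith))]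
  apply le_of_eq; congr 1; rw [div_pow]; ring

lemma le_area_pseudoDisk {z : ℂ} {r : ℝ} (hr0 : 0 < r) (hr : r < 1) (hz : z ∈ disk) :
    ENNReal.ofReal (Real.pi * (r / 2) ^ 2 * defect z ^ 2) ≤ area (pseudoDisk r z) := by
  rw [area_pseudoDisk]
  refine le_trans ?_ (measure_mono (ball_subset_pseudoDisk hr0 hr hz))
  rw [volume_ball_ofReal (mul_nonneg (by linarith) (defect_pos hz).le)]
  apply le_of_eq; congr 1; ring

/-! ### Integrals of Forelli–Rudin type -/

open Set in
lemma lintegral_rpow_mul_max_rpow_le {α s : ℝ} (hα : -1 < α) (hs : α + 1 < s) :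
    ∃ C : ℝ, 0 ≤ C ∧ ∀ ε : ℝ, 0 < ε →
      ∫⁻ x in Ioi (0 : ℝ), ENNReal.ofReal (x ^ α * max ε x ^ (-s)) ≤
        ENNReal.ofReal (C * ε ^ (α + 1 - s)) := by
  have hα' : 0 < α + 1 := by linarith
  have hs' : 0 < s - α - 1 := by linarith
  refine ⟨1 / (α + 1) + 1 / (s - α - 1), by positivity, fun ε hε => ?_⟩
  have h1 : ∫⁻ x in Ioc 0 ε, ENNReal.ofReal (x ^ α * max ε x ^ (-s)) =
      ENNReal.ofReal (1 / (α + 1) * ε ^ (α + 1 - s)) := by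
    have hi : IntegrableOn (fun x : ℝ => x ^ α * ε ^ (-s)) (Ioc 0 ε) :=
      ((intervalIntegrable_iff_integrableOn_Ioc_of_le hε.le).1
        (intervalIntegral.intervalIntegrable_rpow' hα)).mul_const _
    rw [setLIntegral_congr_fun (g := fun x => ENNReal.ofReal (x ^ α * ε ^ (-s)))
      measurableSet_Ioc (fun x hx => by simp only [max_eq_left hx.2]),
      ← ofReal_integral_eq_lintegral_ofReal hi
        (by
          filter_upwards [ae_restrict_mem measurableSet_Ioc] with x hx
          have := hx.1.le
          positivity),
      integral_mul_const, ← intervalIntegral.integral_of_le hε.le, integral_rpow (Or.inl hα),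
      Real.zero_rpow hα'.ne', sub_zero, sub_eq_add_neg (α + 1) s, Real.rpow_add hε (α + 1)]
    congr 1; ring
  have h2 : ∫⁻ x in Ioi ε, ENNReal.ofReal (x ^ α * max ε x ^ (-s)) =
      ENNReal.ofReal (1 / (s - α - 1) * ε ^ (α + 1 - s)) := by
    rw [setLIntegral_congr_fun (g := fun x => ENNReal.ofReal (x ^ (α - s)))
      measurableSet_Ioi (fun x (hx : ε < x) => by
        simp only [max_eq_right hx.le]
        rw [sub_eq_add_neg, Real.rpow_add (hε.trans hx)]),
      ← ofReal_integral_eq_lintegral_ofReal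
        (integrableOn_Ioi_rpow_of_lt (by linarith : α - s < -1) hε)
        (by
          filter_upwards [ae_restrict_mem measurableSet_Ioi] with x hx
          have : 0 < x := hε.trans hx
          positivity),
      integral_Ioi_rpow_of_lt (by linarith) hε]
    congr 1
    rw [show α - s + 1 = -(s - α - 1) by ring, show α + 1 - s = -(s - α - 1) by ring,
      neg_div_neg_eq, one_div, inv_mul_eq_div]
  rw [← Ioc_union_Ioi_eq_Ioi hε.le]
  refine (lintegral_union_le _ _ _).trans ?_
  rw [h1, h2, ← ENNReal.ofReal_add (by positivity) (by positivity), add_mul]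

lemma comparable_defect_one_sub {z : ℂ} (hz : z ∈ disk) :
    Comparable 2 (defect z) (1 - ‖z‖) := by
  rw [mem_disk] at hz
  have := norm_nonneg z
  refine ⟨defect_pos (mem_disk.2 hz), by linarith, ?_, ?_⟩ <;> unfold defect <;> nlinarith

lemma abs_div_pi_le_norm_one_sub {τ θ : ℝ} (hτ0 : 0 ≤ τ) (hτ : τ ≤ 1) (hθ : |θ| ≤ Real.pi) :
    |θ| / Real.pi ≤ ‖1 - τ * Complex.exp (Complex.I * θ)‖ := by
  set e := Complex.exp (Complex.I * θ) with he
  have hen : ‖e‖ = 1 := by rw [he, mul_comm, Complex.norm_exp_ofReal_mul_I]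
  have h1 : ‖e - 1‖ = 2 * |Real.sin (θ / 2)| := by
    rw [he, Complex.norm_exp_I_mul_ofReal_sub_one]; simp
  have h2 : 2 / Real.pi * |θ / 2| ≤ |Real.sin (θ / 2)| :=
    Real.mul_abs_le_abs_sin (by rw [abs_div, abs_two]; linarith)
  have h3 : ‖e - 1‖ ≤ ‖1 - τ * e‖ + (1 - τ) := by
    calc ‖e - 1‖ = ‖(1 - τ : ℂ) * e - (1 - τ * e)‖ := by congr 1; ring
      _ ≤ ‖(1 - τ : ℂ) * e‖ + ‖1 - τ * e‖ := norm_sub_le _ _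
      _ = (1 - τ) + ‖1 - τ * e‖ := by
        rw [norm_mul, hen, mul_one, ← Complex.ofReal_one, ← Complex.ofReal_sub,
          Complex.norm_real, Real.norm_of_nonneg (by linarith), Complex.ofReal_one]
      _ = _ := add_comm _ _
  have h4 : 1 - τ ≤ ‖1 - τ * e‖ := by
    have := norm_sub_norm_le (1 : ℂ) (τ * e)
    rwa [norm_one, norm_mul, hen, Complex.norm_real, Real.norm_of_nonneg hτ0, mul_one] at this
  have h5 : 2 / Real.pi * |θ / 2| = |θ| / Real.pi := by rw [abs_div, abs_two]; ring
  linarith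

/-- The tensor bound in polar coordinates `z = r e^{iθ}`: the power of `|1 - ρ z|` is dominated by
a product of a function of `r` and a function of `θ`. -/
lemma norm_one_sub_rpow_le {ρ r θ s₁ s₂ : ℝ} (hρ0 : 0 ≤ ρ) (hρ : ρ < 1) (hr0 : 0 ≤ r) (hr : r < 1)
    (hθ : |θ| ≤ Real.pi) (hs₁ : 0 ≤ s₁) (hs₂ : 0 ≤ s₂) :
    ‖1 - ρ * (r * Complex.exp (Complex.I * θ))‖ ^ (-(s₁ + s₂)) ≤
      max (1 - ρ) (1 - r) ^ (-s₁) * (Real.pi ^ s₂ * max (1 - ρ) |θ| ^ (-s₂)) := by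
  have hτ0 : 0 ≤ ρ * r := by positivity
  have hτρ : ρ * r ≤ ρ := by nlinarith
  have hτr : ρ * r ≤ r := by nlinarith
  have e1 : (1 : ℂ) - ρ * (r * Complex.exp (Complex.I * θ)) =
      1 - (ρ * r : ℝ) * Complex.exp (Complex.I * θ) := by push_cast; ring
  rw [e1]
  set N := ‖(1 : ℂ) - (ρ * r : ℝ) * Complex.exp (Complex.I * θ)‖ with hN
  have h4 : 1 - ρ * r ≤ N := by
    have := norm_sub_norm_le (1 : ℂ) ((ρ * r : ℝ) * Complex.exp (Complex.I * θ))
    rwa [norm_one, norm_mul, mul_comm Complex.I, Complex.norm_exp_ofReal_mul_I, Complex.norm_real,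
      Real.norm_of_nonneg hτ0, mul_one, mul_comm (θ : ℂ), ← hN] at this
  have hNpos : 0 < N := by linarith
  have h5 := abs_div_pi_le_norm_one_sub hτ0 (by linarith) hθ
  rw [← hN] at h5
  have hm1 : max (1 - ρ) (1 - r) ≤ N := max_le (by linarith) (by linarith)
  have hpi := Real.pi_pos
  have hm2 : max (1 - ρ) |θ| / Real.pi ≤ N := by
    rw [div_le_iff₀ hpi] at h5 ⊢
    refine max_le ?_ h5
    nlinarith [Real.pi_gt_three]
  have p1 : 0 < max (1 - ρ) (1 - r) := lt_max_of_lt_left (by linarith)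
  have p2 : 0 < max (1 - ρ) |θ| := lt_max_of_lt_left (by linarith)
  rw [neg_add, Real.rpow_add hNpos]
  refine mul_le_mul (Real.rpow_le_rpow_of_nonpos p1 hm1 (by linarith)) ?_ (by positivity)
    (by positivity)
  refine (Real.rpow_le_rpow_of_nonpos (by positivity) hm2 (by linarith)).trans (le_of_eq ?_)
  rw [Real.div_rpow p2.le hpi.le, Real.rpow_neg hpi.le, div_inv_eq_mul, mul_comm]

/-- An integral over the plane is bounded by a product of a radial and an angular integral, if the
integrand in polar coordinates, including the Jacobian `r`, is bounded by a product. -/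
lemma lintegral_polarCoord_le {f : ℂ → ENNReal} {G H : ℝ → ENNReal} (hG : Measurable G)
    (hH : Measurable H)
    (h : ∀ r θ : ℝ, 0 < r → |θ| ≤ Real.pi →
      ENNReal.ofReal r * f (r * Complex.exp (Complex.I * θ)) ≤ G r * H θ) :
    ∫⁻ z, f z ≤ (∫⁻ r in Set.Ioi 0, G r) * ∫⁻ θ in Set.Ioo (-Real.pi) Real.pi, H θ := by
  rw [← Complex.lintegral_comp_polarCoord_symm, ← lintegral_prod_mul hG.aemeasurable
    hH.aemeasurable, Measure.prod_restrict, polarCoord_target, Measure.volume_eq_prod]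
  refine setLIntegral_mono' (measurableSet_Ioi.prod measurableSet_Ioo) ?_
  rintro ⟨r, θ⟩ ⟨hr, hθ⟩
  have := h r θ hr (abs_le.2 ⟨hθ.1.le, hθ.2.le⟩)
  rw [mul_comm Complex.I, Complex.exp_mul_I, ← Complex.ofReal_cos, ← Complex.ofReal_sin] at this
  rwa [Complex.polarCoord_symm_apply, smul_eq_mul]

/-- The integral is unchanged by the rotation which takes `‖u‖` to `u`. -/
lemma lintegral_rotation {u : ℂ} (f : ℂ → ENNReal) (hf : Measurable f) :
    ∃ c : ℂ, ‖c‖ = 1 ∧ u = ‖u‖ * c ∧ ∫⁻ z, f z = ∫⁻ z, f (c * z) := by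
  refine ⟨Circle.exp u.arg, by simp, by simp, ?_⟩
  have := (rotation (Circle.exp u.arg)).measurePreserving.lintegral_comp hf
  rw [← this]
  simp [rotation_apply]

open Set in
lemma lintegral_max_abs_rpow_le {s : ℝ} (hs : 1 < s) :
    ∃ C : ℝ, 0 ≤ C ∧ ∀ ε : ℝ, 0 < ε →
      ∫⁻ x : ℝ, ENNReal.ofReal (max ε |x| ^ (-s)) ≤ ENNReal.ofReal (C * ε ^ (1 - s)) := by
  obtain ⟨C, hC, h⟩ := lintegral_rpow_mul_max_rpow_le (α := 0) (s := s) (by norm_num) (by linarith)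
  refine ⟨C + C, by positivity, fun ε hε => ?_⟩
  specialize h ε hε
  simp only [Real.rpow_zero, one_mul, zero_add] at h
  rw [Measure.restrict_congr_set Ioi_ae_eq_Ici, ← lintegral_indicator measurableSet_Ici] at h
  have h' := h
  rw [← lintegral_neg_eq_self] at h'
  rw [add_mul, ENNReal.ofReal_add (by positivity) (by positivity)]
  refine le_trans ?_ (add_le_add h h')
  rw [← lintegral_add_left]
  · refine lintegral_mono fun x => ?_
    rcases le_total 0 x with hx | hx
    · rw [indicator_of_mem (mem_Ici.2 hx), abs_of_nonneg hx]
      exact le_self_add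
    · rw [indicator_of_mem (s := Ici (0 : ℝ)) (a := -x) (by simpa using hx), abs_of_nonpos hx]
      exact le_add_self
  · exact Measurable.indicator (by fun_prop) measurableSet_Ici

/-- The Forelli–Rudin estimate. -/
lemma lintegral_defect_rpow_le {α s : ℝ} (hα : -1 < α) (hs : α + 2 < s) :
    ∃ C : ℝ, 0 ≤ C ∧ ∀ u ∈ disk,
      ∫⁻ z, ENNReal.ofReal (defect z ^ α * ‖1 - star u * z‖ ^ (-s)) ∂area ≤
        ENNReal.ofReal (C * defect u ^ (α + 2 - s)) := by
  -- Split `s` so that the radial and the angular integral both converge.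
  obtain ⟨s₁, s₂, rfl, hs₁, hs₂⟩ : ∃ s₁ s₂, s = s₁ + s₂ ∧ α + 1 < s₁ ∧ 1 < s₂ :=
    ⟨(s + α) / 2, (s - α) / 2, by ring, by linarith, by linarith⟩
  obtain ⟨C₁, hC₁, h₁⟩ := lintegral_rpow_mul_max_rpow_le hα hs₁
  obtain ⟨C₂, hC₂, h₂⟩ := lintegral_max_abs_rpow_le hs₂
  refine ⟨2 ^ |α| * Real.pi ^ s₂ * C₁ * C₂ * 2 ^ |α + 2 - (s₁ + s₂)|, by positivity,
    fun u hu => ?_⟩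
  have hu' := mem_disk.1 hu
  have hε : 0 < 1 - ‖u‖ := by linarith
  set ε := 1 - ‖u‖ with hεdef
  set f : ℂ → ENNReal := disk.indicator
    fun z => ENNReal.ofReal (defect z ^ α * ‖1 - star u * z‖ ^ (-(s₁ + s₂))) with hf
  have hfm : Measurable f := by
    refine Measurable.indicator ?_ measurableSet_disk
    unfold defect; fun_prop
  obtain ⟨c, hc, huc, hrot⟩ := lintegral_rotation (u := u) f hfm
  have hfc : ∀ z, f (c * z) = disk.indicator
      (fun z => ENNReal.ofReal (defect z ^ α * ‖1 - ‖u‖ * z‖ ^ (-(s₁ + s₂)))) z := by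
    intro z
    have e1 : c * z ∈ disk ↔ z ∈ disk := by simp [mem_disk, hc]
    have e2 : defect (c * z) = defect z := by simp [defect, hc]
    have e3 : star u * (c * z) = ‖u‖ * z := by
      rw [huc, Complex.star_def, map_mul, Complex.conj_ofReal, norm_mul, hc, Complex.norm_real,
        norm_norm, mul_one]
      have : (starRingEnd ℂ) c * c = 1 := by rw [Complex.conj_mul', hc]; simp
      linear_combination (‖u‖ * z : ℂ) * this
    by_cases hz : z ∈ disk
    · rw [hf, Set.indicator_of_mem (e1.2 hz), Set.indicator_of_mem hz, e2, e3]
    · rw [hf, Set.indicator_of_notMem (mt e1.1 hz), Set.indicator_of_notMem hz]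
  set g : ℝ → ENNReal := (Set.Ioi (0 : ℝ)).indicator
    fun x => ENNReal.ofReal (x ^ α * max ε x ^ (-s₁)) with hg
  have hgm : Measurable g := by
    refine Measurable.indicator ?_ measurableSet_Ioi
    fun_prop
  set H : ℝ → ENNReal := fun θ => ENNReal.ofReal (2 ^ |α| * Real.pi ^ s₂) *
    ENNReal.ofReal (max ε |θ| ^ (-s₂)) with hH
  -- The Jacobian `r` is bounded by `1` and discarded.
  have key : ∀ r θ : ℝ, 0 < r → |θ| ≤ Real.pi →
      ENNReal.ofReal r * f (c * (r * Complex.exp (Complex.I * θ))) ≤ g (1 - r) * H θ := by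
    intro r θ hr hθ
    have hn : ‖r * Complex.exp (Complex.I * θ)‖ = r := by
      rw [norm_mul, mul_comm, Complex.norm_real, mul_comm Complex.I,
        Complex.norm_exp_ofReal_mul_I, one_mul, Real.norm_of_nonneg hr.le]
    rw [hfc]
    by_cases hz : (r * Complex.exp (Complex.I * θ) : ℂ) ∈ disk
    · have hr1 : r < 1 := by rwa [mem_disk, hn] at hz
      have b1 := (comparable_defect_one_sub hz).rpow_le α
      rw [hn] at b1
      have b2 := norm_one_sub_rpow_le (norm_nonneg u) hu' hr.le hr1 hθ
        (by linarith : 0 ≤ s₁) (by linarith : 0 ≤ s₂)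
      rw [Set.indicator_of_mem hz, hg, Set.indicator_of_mem (by simpa using hr1), hH]
      simp only []
      have d1 : 0 < 1 - r := by linarith
      have d2 : 0 < max ε (1 - r) := lt_max_of_lt_left hε
      rw [← ENNReal.ofReal_mul hr.le, ← ENNReal.ofReal_mul (by positivity),
        ← ENNReal.ofReal_mul (by positivity)]
      refine ENNReal.ofReal_le_ofReal ?_
      have d3 := defect_pos hz
      calc _ ≤ 1 * (2 ^ |α| * (1 - r) ^ α *
            (max ε (1 - r) ^ (-s₁) * (Real.pi ^ s₂ * max ε |θ| ^ (-s₂)))) := by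
            gcongr
        _ = _ := by ring
    · rw [Set.indicator_of_notMem hz, mul_zero]
      exact zero_le
  have hHm : Measurable H := by rw [hH]; fun_prop
  calc ∫⁻ z, ENNReal.ofReal (defect z ^ α * ‖1 - star u * z‖ ^ (-(s₁ + s₂))) ∂area
      = ∫⁻ z, f (c * z) := by rw [area, ← lintegral_indicator measurableSet_disk, ← hrot]
    _ ≤ (∫⁻ r in Set.Ioi 0, g (1 - r)) * ∫⁻ θ in Set.Ioo (-Real.pi) Real.pi, H θ :=
        lintegral_polarCoord_le (by fun_prop) hHm key
    _ ≤ (∫⁻ r, g (1 - r)) * ∫⁻ θ, H θ := by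
        gcongr <;> exact Measure.restrict_le_self
    _ = (∫⁻ x in Set.Ioi 0, ENNReal.ofReal (x ^ α * max ε x ^ (-s₁))) *
          (ENNReal.ofReal (2 ^ |α| * Real.pi ^ s₂) *
            ∫⁻ θ, ENNReal.ofReal (max ε |θ| ^ (-s₂))) := by
        rw [lintegral_sub_left_eq_self, hg, lintegral_indicator measurableSet_Ioi, hH,
          lintegral_const_mul' _ _ ENNReal.ofReal_ne_top]
    _ ≤ ENNReal.ofReal (C₁ * ε ^ (α + 1 - s₁)) *
          (ENNReal.ofReal (2 ^ |α| * Real.pi ^ s₂) * ENNReal.ofReal (C₂ * ε ^ (1 - s₂))) := by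
        gcongr
        exacts [h₁ ε hε, h₂ ε hε]
    _ = ENNReal.ofReal (2 ^ |α| * Real.pi ^ s₂ * C₁ * C₂ * ε ^ (α + 2 - (s₁ + s₂))) := by
        rw [← ENNReal.ofReal_mul (by positivity), ← ENNReal.ofReal_mul (by positivity),
          show α + 2 - (s₁ + s₂) = (α + 1 - s₁) + (1 - s₂) by ring, Real.rpow_add hε]
        congr 1; ring
    _ ≤ _ := by
        refine ENNReal.ofReal_le_ofReal ?_
        have := (comparable_defect_one_sub hu).symm.rpow_le (α + 2 - (s₁ + s₂))
        rw [mul_assoc _ (2 ^ |α + 2 - (s₁ + s₂)|)]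
        gcongr

/-- The singularity `1 / |z - w|` is integrable over disks, with integral at most `2 π t` over a
disk of radius `t`. -/
lemma lintegral_ball_inv_norm_le (z : ℂ) (t : ℝ) :
    ∫⁻ w in Metric.ball z t, ENNReal.ofReal ‖z - w‖⁻¹ ≤ ENNReal.ofReal (2 * Real.pi * t) := by
  have h0 : ∫⁻ w in Metric.ball z t, ENNReal.ofReal ‖z - w‖⁻¹ =
      ∫⁻ v, (Metric.ball (0 : ℂ) t).indicator (fun v => ENNReal.ofReal ‖v‖⁻¹) v := by
    rw [← lintegral_indicator Metric.isOpen_ball.measurableSet,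
      ← lintegral_sub_left_eq_self _ z]
    refine lintegral_congr fun w => ?_
    simp only [Set.indicator, mem_ball_iff_norm, sub_sub_cancel, sub_sub_cancel_left, norm_neg,
      sub_zero]
  rw [h0]
  refine (lintegral_polarCoord_le (G := (Set.Iio t).indicator 1) (H := 1)
    (measurable_one.indicator measurableSet_Iio) measurable_one ?_).trans ?_
  · intro r θ hr _
    have hn : ‖r * Complex.exp (Complex.I * θ)‖ = r := by
      rw [norm_mul, mul_comm, Complex.norm_real, mul_comm Complex.I,
        Complex.norm_exp_ofReal_mul_I, one_mul, Real.norm_of_nonneg hr.le]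
    by_cases hrt : r < t
    · rw [Set.indicator_of_mem (by rwa [mem_ball_zero_iff, hn]), hn, ← ENNReal.ofReal_mul hr.le,
        mul_inv_cancel₀ hr.ne', Set.indicator_of_mem (Set.mem_Iio.2 hrt)]
      simp
    · rw [Set.indicator_of_notMem (by rwa [mem_ball_zero_iff, hn]), mul_zero]
      exact zero_le
  · rw [lintegral_indicator measurableSet_Iio, Measure.restrict_restrict measurableSet_Iio]
    simp only [Pi.one_apply, lintegral_one, Measure.restrict_apply_univ]
    rw [Set.inter_comm, Set.Ioi_inter_Iio, Real.volume_Ioo, Real.volume_Ioo, sub_zero, mul_comm,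
      ← ENNReal.ofReal_mul (by linarith [Real.pi_pos])]
    apply le_of_eq; congr 1; ring

/-! ### The invariant measure and a covering inequality -/

/-- The Möbius invariant measure `(1 - |z|²)⁻² dA` on the disk. -/
noncomputable def invArea : Measure ℂ :=
  area.withDensity fun u => ENNReal.ofReal (defect u ^ (-2 : ℝ))

instance : SFinite area := by unfold area; infer_instance

instance : SFinite invArea := by unfold invArea; infer_instance

lemma measurable_defect : Measurable defect := by unfold defect; fun_prop

lemma lintegral_invArea (F : ℂ → ENNReal) :
    ∫⁻ u, F u ∂invArea = ∫⁻ u, ENNReal.ofReal (defect u ^ (-2 : ℝ)) * F u ∂area := by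
  rw [invArea, lintegral_withDensity_eq_lintegral_mul_non_measurable _
    (measurable_defect.pow_const _).ennreal_ofReal (by simp)]
  rfl

lemma ae_invArea_mem_disk : ∀ᵐ u ∂invArea, u ∈ disk :=
  (withDensity_absolutelyContinuous _ _).ae_le ae_mem_disk

lemma self_mem_pseudoDisk {r : ℝ} (hr : 0 < r) {z : ℂ} (hz : z ∈ disk) : z ∈ pseudoDisk r z :=
  ⟨hz, by simpa [pseudoDist] using hr⟩

/-- Pseudohyperbolic disks of a fixed radius have invariant area bounded below. -/
lemma exists_le_invArea_pseudoDisk {r : ℝ} (hr0 : 0 < r) (hr : r < 1) :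
    ∃ c : ENNReal, c ≠ 0 ∧ c ≠ ⊤ ∧ ∀ u ∈ disk, c ≤ invArea (pseudoDisk r u) := by
  set M := 2 / (1 - r) with hM
  have hM0 : 0 < M := div_pos two_pos (by linarith)
  refine ⟨ENNReal.ofReal ((M ^ |(-2 : ℝ)|)⁻¹ * (Real.pi * (r / 2) ^ 2)), ?_, ENNReal.ofReal_ne_top,
    fun u hu => ?_⟩
  · rw [Ne, ENNReal.ofReal_eq_zero, not_le]
    have := Real.pi_pos
    positivity
  have hd := defect_pos hu
  rw [invArea, withDensity_apply _ (measurableSet_pseudoDisk r u)]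
  calc ENNReal.ofReal ((M ^ |(-2 : ℝ)|)⁻¹ * (Real.pi * (r / 2) ^ 2))
      = ENNReal.ofReal ((M ^ |(-2 : ℝ)|)⁻¹ * defect u ^ (-2 : ℝ)) *
          ENNReal.ofReal (Real.pi * (r / 2) ^ 2 * defect u ^ 2) := by
        rw [← ENNReal.ofReal_mul (by positivity), Real.rpow_neg hd.le, Real.rpow_two]
        congr 1; field_simp
    _ ≤ ENNReal.ofReal ((M ^ |(-2 : ℝ)|)⁻¹ * defect u ^ (-2 : ℝ)) * area (pseudoDisk r u) := by
        gcongr; exact le_area_pseudoDisk hr0 hr hu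
    _ = ∫⁻ w in pseudoDisk r u,
          ENNReal.ofReal ((M ^ |(-2 : ℝ)|)⁻¹ * defect u ^ (-2 : ℝ)) ∂area := by
        rw [setLIntegral_const]
    _ ≤ _ := by
        refine setLIntegral_mono' (measurableSet_pseudoDisk r u) fun w hw => ?_
        refine ENNReal.ofReal_le_ofReal ?_
        rw [inv_mul_le_iff₀ (by positivity)]
        exact (comparable_defect hr hu hw.1 hw.2).rpow_le _

lemma measurable_setLIntegral_pseudoDisk (r : ℝ) {F : ℂ → ℂ → ENNReal}
    (hF : Measurable (Function.uncurry F)) :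
    Measurable fun u => ∫⁻ w in pseudoDisk r u, F u w ∂area := by
  have h : ∀ u, ∫⁻ w in pseudoDisk r u, F u w ∂area =
      ∫⁻ w, {x : ℂ × ℂ | x.2 ∈ pseudoDisk r x.1}.indicator (Function.uncurry F) (u, w) ∂area := by
    intro u
    rw [← lintegral_indicator (measurableSet_pseudoDisk r u)]
    rfl
  simp_rw [h]
  exact (hF.indicator (measurableSet_pseudoDisk_prod r)).lintegral_prod_right'

/-- An integral over the disk is controlled by the integrals over pseudohyperbolic disks. -/
lemma exists_lintegral_le_lintegral_setLIntegral {r : ℝ} (hr0 : 0 < r) (hr : r < 1) :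
    ∃ C : ENNReal, C ≠ ⊤ ∧ ∀ F : ℂ → ENNReal, Measurable F →
      ∫⁻ w, F w ∂area ≤ C * ∫⁻ u, ∫⁻ w in pseudoDisk r u, F w ∂area ∂invArea := by
  obtain ⟨c, hc0, hc, h⟩ := exists_le_invArea_pseudoDisk hr0 hr
  refine ⟨c⁻¹, ENNReal.inv_ne_top.2 hc0, fun F hF => ?_⟩
  rw [mul_comm, ← div_eq_mul_inv, ENNReal.le_div_iff_mul_le (Or.inl hc0) (Or.inl hc)]
  set S := {x : ℂ × ℂ | x.2 ∈ pseudoDisk r x.1} with hS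
  have hSm := measurableSet_pseudoDisk_prod r
  calc (∫⁻ w, F w ∂area) * c = ∫⁻ w, F w * c ∂area := (lintegral_mul_const' _ _ hc).symm
    _ ≤ ∫⁻ w, ∫⁻ u, S.indicator (fun x => F x.2) (u, w) ∂invArea ∂area := by
        refine lintegral_mono_ae ?_
        filter_upwards [ae_mem_disk] with w hw
        calc F w * c ≤ F w * invArea (pseudoDisk r w) := by gcongr; exact h w hw
          _ = ∫⁻ u in pseudoDisk r w, F w ∂invArea := by rw [setLIntegral_const]
          _ = ∫⁻ u, (pseudoDisk r w).indicator (fun _ => F w) u ∂invArea := by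
              rw [lintegral_indicator (measurableSet_pseudoDisk r w)]
          _ ≤ _ := by
              refine lintegral_mono fun u => ?_
              refine Set.indicator_le_indicator_of_subset (s := pseudoDisk r w)
                (t := {u | (u, w) ∈ S}) ?_ (fun _ => zero_le) u
              exact fun u hu => (mem_pseudoDisk_comm hw hu.1).1 hu
    _ = ∫⁻ u, ∫⁻ w, S.indicator (fun x => F x.2) (u, w) ∂area ∂invArea := by
        rw [lintegral_lintegral_swap]
        exact (((hF.comp measurable_snd).indicator hSm).comp measurable_swap).aemeasurable
    _ = _ := by
        refine lintegral_congr fun u => ?_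
        rw [← lintegral_indicator (measurableSet_pseudoDisk r u)]
        rfl

/-- The embedding of `ℓ^p` into `ℓ^1` for `p ≤ 1`, for functions which vary slowly at the scale
of sets `E u` of measure bounded below: such a `g` is bounded by its `p`-th power integral, and the
remaining power `g ^ p` is integrated. -/
lemma mul_rpow_lintegral_le {X : Type*} [MeasurableSpace X] {μ : Measure X} {E : X → Set X}
    {g g' : X → ENNReal} {c : ENNReal} {p : ℝ} (hp0 : 0 < p) (hp1 : p ≤ 1)
    (hc0 : c ≠ 0) (hc1 : c ≤ 1) (hE : ∀ u, MeasurableSet (E u))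
    (h : ∀ᵐ u ∂μ, c ≤ μ (E u) ∧ u ∈ E u ∧ ∀ v ∈ E u, g u ≤ g' v) :
    c * (∫⁻ u, g u ∂μ) ^ p ≤ ∫⁻ u, g' u ^ p ∂μ := by
  have hc : c ≠ ⊤ := (hc1.trans_lt ENNReal.one_lt_top).ne
  rw [mul_comm, ← ENNReal.le_div_iff_mul_le (Or.inl hc0) (Or.inl hc), div_eq_mul_inv, mul_comm]
  set S := c⁻¹ * ∫⁻ u, g' u ^ p ∂μ with hS
  have h1 : ∀ᵐ u ∂μ, g u ^ p ≤ S := by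
    filter_upwards [h] with u hu
    rw [hS, mul_comm, ← div_eq_mul_inv, ENNReal.le_div_iff_mul_le (Or.inl hc0) (Or.inl hc)]
    calc g u ^ p * c ≤ g u ^ p * μ (E u) := by gcongr; exact hu.1
      _ = ∫⁻ v in E u, g u ^ p ∂μ := by rw [setLIntegral_const]
      _ ≤ ∫⁻ v in E u, g' v ^ p ∂μ :=
          setLIntegral_mono' (hE u) fun v hv => ENNReal.rpow_le_rpow (hu.2.2 v hv) hp0.le
      _ ≤ _ := setLIntegral_le_lintegral _ _
  have h2 : ∫⁻ u, g' u ^ p ∂μ ≤ S := by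
    rw [hS]
    calc _ = 1 * ∫⁻ u, g' u ^ p ∂μ := (one_mul _).symm
      _ ≤ _ := by gcongr; exact ENNReal.one_le_inv.2 hc1
  rcases eq_or_ne S ⊤ with hST | hST
  · rw [hST]; exact le_top
  have hp : 0 ≤ (1 - p) / p := div_nonneg (by linarith) hp0.le
  have h3 : ∫⁻ u, g u ∂μ ≤ S ^ (1 / p) := by
    calc ∫⁻ u, g u ∂μ ≤ ∫⁻ u, S ^ ((1 - p) / p) * g' u ^ p ∂μ := by
          refine lintegral_mono_ae ?_
          filter_upwards [h, h1] with u hu hu1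
          calc g u = g u ^ ((1 - p) + p) := by simp
            _ = (g u ^ p) ^ ((1 - p) / p) * g u ^ p := by
                rw [ENNReal.rpow_add_of_nonneg _ _ (by linarith) hp0.le, ← ENNReal.rpow_mul]
                congr 2; field_simp
            _ ≤ S ^ ((1 - p) / p) * g' u ^ p := by gcongr; exact hu.2.2 u hu.2.1
      _ = S ^ ((1 - p) / p) * ∫⁻ u, g' u ^ p ∂μ :=
          lintegral_const_mul' _ _ (ENNReal.rpow_ne_top_of_nonneg hp hST)
      _ ≤ S ^ ((1 - p) / p) * S ^ (1 : ℝ) := by rw [ENNReal.rpow_one]; gcongr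
      _ = S ^ (1 / p) := by
          rw [← ENNReal.rpow_add_of_nonneg _ _ hp zero_le_one]
          congr 1; field_simp; ring
  calc (∫⁻ u, g u ∂μ) ^ p ≤ (S ^ (1 / p)) ^ p := by gcongr
    _ = S := by rw [← ENNReal.rpow_mul, one_div_mul_cancel hp0.ne', ENNReal.rpow_one]

/-! ### The kernel `K` -/

lemma kernelK_eq (a b : ℝ) (z w : ℂ) : kernelK a b z w =
    defect z ^ a * defect w ^ b * ‖1 - star w * z‖ ^ (-(a + b + 2)) := by
  rw [Real.rpow_neg (norm_nonneg _), ← div_eq_mul_inv]; rfl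

lemma kernelK_nonneg (a b : ℝ) {z w : ℂ} (hz : z ∈ disk) (hw : w ∈ disk) :
    0 ≤ kernelK a b z w := by
  have := defect_pos hz
  have := defect_pos hw
  rw [kernelK_eq]; positivity

lemma measurable_star_snd : Measurable (fun x : ℂ × ℂ => star x.2) :=
  continuous_star.measurable.comp measurable_snd

lemma measurable_kernelK (a b : ℝ) : Measurable (Function.uncurry (kernelK a b)) := by
  have := measurable_star_snd
  unfold Function.uncurry kernelK
  fun_prop

lemma kernelK_le_right {a b R : ℝ} (hR : R < 1) {z w u : ℂ} (hz : z ∈ disk) (hw : w ∈ disk)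
    (hu : u ∈ disk) (h : pseudoDist w u < R) :
    kernelK a b z w ≤ (2 / (1 - R)) ^ |b| * (2 / (1 - R)) ^ |-(a + b + 2)| * kernelK a b z u := by
  have h1 := (comparable_defect hR hw hu h).rpow_le b
  have h2 := (comparable_norm' hR hw hu hz h).rpow_le (-(a + b + 2))
  have := defect_pos hz
  have := defect_pos hw
  have := defect_pos hu
  have : 0 < 2 / (1 - R) := div_pos two_pos (by linarith)
  rw [kernelK_eq, kernelK_eq]
  calc _ ≤ defect z ^ a * ((2 / (1 - R)) ^ |b| * defect u ^ b) *
        ((2 / (1 - R)) ^ |-(a + b + 2)| * ‖1 - star u * z‖ ^ (-(a + b + 2))) := by gcongr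
    _ = _ := by ring

lemma kernelK_le_left {a b R : ℝ} (hR : R < 1) {z w u : ℂ} (hz : z ∈ disk) (hw : w ∈ disk)
    (hu : u ∈ disk) (h : pseudoDist z u < R) :
    kernelK a b z w ≤ (2 / (1 - R)) ^ |a| * (2 / (1 - R)) ^ |-(a + b + 2)| * kernelK a b u w := by
  have h1 := (comparable_defect hR hz hu h).rpow_le a
  have h2 := (comparable_norm hR hz hu hw h).rpow_le (-(a + b + 2))
  have := defect_pos hz
  have := defect_pos hw
  have := defect_pos hu
  have : 0 < 2 / (1 - R) := div_pos two_pos (by linarith)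
  rw [kernelK_eq, kernelK_eq]
  calc _ ≤ ((2 / (1 - R)) ^ |a| * defect u ^ a) * defect w ^ b *
        ((2 / (1 - R)) ^ |-(a + b + 2)| * ‖1 - star w * u‖ ^ (-(a + b + 2))) := by gcongr
    _ = _ := by ring

/-- The operator with kernel `K`, acting on functions with values in `[0, ∞]`. -/
noncomputable def opK (a b : ℝ) (F : ℂ → ENNReal) (z : ℂ) : ENNReal :=
  ∫⁻ w, ENNReal.ofReal (kernelK a b z w) * F w ∂area

/-- The average of `F` over the pseudohyperbolic disk with center `z` and radius `R`. -/
noncomputable def average (R : ℝ) (F : ℂ → ENNReal) (z : ℂ) : ENNReal :=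
  (area (pseudoDisk R z))⁻¹ * ∫⁻ w in pseudoDisk R z, F w ∂area

lemma localMean_eq (R q : ℝ) (f : ℂ → ℂ) (z : ℂ) :
    localMean R q f z = average R (fun w => ‖f w‖ₑ ^ q) z ^ (1 / q) := rfl

/-- The integrals of the `p`-th power of `K` in its first variable. -/
lemma exists_lintegral_kernelK_rpow_le {a b p : ℝ} (hp0 : 0 < p) (ha : -1 < a * p)
    (hb : 2 < (b + 2) * p) :
    ∃ C : ENNReal, C ≠ ⊤ ∧ ∀ u ∈ disk, ∫⁻ z, ENNReal.ofReal (kernelK a b z u) ^ p ∂area ≤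
      C * ENNReal.ofReal (defect u ^ (2 - 2 * p)) := by
  obtain ⟨C, hC, h⟩ := lintegral_defect_rpow_le ha
    (by linarith [show (a + b + 2) * p = a * p + (b + 2) * p by ring] :
      a * p + 2 < (a + b + 2) * p)
  refine ⟨ENNReal.ofReal C, ENNReal.ofReal_ne_top, fun u hu => ?_⟩
  have hd := defect_pos hu
  calc ∫⁻ z, ENNReal.ofReal (kernelK a b z u) ^ p ∂area
      = ∫⁻ z, ENNReal.ofReal (defect u ^ (b * p)) *
          ENNReal.ofReal (defect z ^ (a * p) * ‖1 - star u * z‖ ^ (-((a + b + 2) * p))) ∂area := by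
        refine lintegral_congr_ae ?_
        filter_upwards [ae_mem_disk] with z hz
        have hdz := defect_pos hz
        rw [ENNReal.ofReal_rpow_of_nonneg (kernelK_nonneg a b hz hu) hp0.le,
          ← ENNReal.ofReal_mul (by positivity), kernelK_eq, Real.mul_rpow (by positivity)
          (by positivity), Real.mul_rpow (by positivity) (by positivity), ← Real.rpow_mul hdz.le,
          ← Real.rpow_mul hd.le, ← Real.rpow_mul (norm_nonneg _), ← neg_mul]
        congr 1; ring
    _ = ENNReal.ofReal (defect u ^ (b * p)) * ∫⁻ z,
          ENNReal.ofReal (defect z ^ (a * p) * ‖1 - star u * z‖ ^ (-((a + b + 2) * p))) ∂area :=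
        lintegral_const_mul' _ _ ENNReal.ofReal_ne_top
    _ ≤ ENNReal.ofReal (defect u ^ (b * p)) *
          ENNReal.ofReal (C * defect u ^ (a * p + 2 - (a + b + 2) * p)) := by
        gcongr; exact h u hu
    _ = _ := by
        rw [← ENNReal.ofReal_mul (by positivity), ← ENNReal.ofReal_mul hC,
          show 2 - 2 * p = b * p + (a * p + 2 - (a + b + 2) * p) by ring, Real.rpow_add hd (b * p)]
        congr 1; ring

lemma exists_inv_area_pseudoDisk_le {R : ℝ} (hR0 : 0 < R) (hR1 : R < 1) :
    ∃ C : ENNReal, C ≠ ⊤ ∧ ∀ u ∈ disk,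
      (area (pseudoDisk R u))⁻¹ ≤ C * ENNReal.ofReal (defect u ^ (-2 : ℝ)) := by
  have := Real.pi_pos
  refine ⟨ENNReal.ofReal (Real.pi * (R / 2) ^ 2)⁻¹, ENNReal.ofReal_ne_top, fun u hu => ?_⟩
  have hd := defect_pos hu
  refine (ENNReal.inv_le_inv.2 (le_area_pseudoDisk hR0 hR1 hu)).trans (le_of_eq ?_)
  rw [← ENNReal.ofReal_inv_of_pos (by positivity), ← ENNReal.ofReal_mul (by positivity),
    Real.rpow_neg hd.le, Real.rpow_two, mul_inv _ (defect u ^ 2)]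

lemma exists_le_inv_area_pseudoDisk {R : ℝ} (hR0 : 0 < R) (hR1 : R < 1) :
    ∃ C : ENNReal, C ≠ ⊤ ∧ ∀ u ∈ disk,
      ENNReal.ofReal (defect u ^ (-2 : ℝ)) ≤ C * (area (pseudoDisk R u))⁻¹ := by
  have := Real.pi_pos
  have hR : 0 < 1 - R := by linarith
  refine ⟨ENNReal.ofReal (Real.pi / (1 - R) ^ 2), ENNReal.ofReal_ne_top, fun u hu => ?_⟩
  have hd := defect_pos hu
  refine le_trans (le_of_eq ?_)
    (mul_le_mul_right (ENNReal.inv_le_inv.2 (area_pseudoDisk_le hR0 hR1 hu)) _)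
  rw [← ENNReal.ofReal_inv_of_pos (by positivity), ← ENNReal.ofReal_mul (by positivity),
    Real.rpow_neg hd.le, Real.rpow_two]
  congr 1; field_simp

/-- The pointwise form of the estimate for `K`: for `p ≤ 1` the `p`-th power can be moved inside
the integral, at the cost of replacing `F` by its integrals over pseudohyperbolic disks. -/
lemma exists_opK_rpow_le {a b p R : ℝ} (hR0 : 0 < R) (hR1 : R < 1) (hp0 : 0 < p) (hp1 : p ≤ 1) :
    ∃ C : ENNReal, C ≠ ⊤ ∧ ∀ F : ℂ → ENNReal, Measurable F → ∀ z ∈ disk,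
      opK a b F z ^ p ≤ C * ∫⁻ u, (ENNReal.ofReal (kernelK a b z u) *
        ∫⁻ w in pseudoDisk R u, F w ∂area) ^ p ∂invArea := by
  obtain ⟨C₁, hC₁, h₁⟩ := exists_lintegral_le_lintegral_setLIntegral
    (by linarith : 0 < R / 8) (by linarith)
  obtain ⟨c₀, hc₀, -, hc⟩ := exists_le_invArea_pseudoDisk (by linarith : 0 < R / 8) (by linarith)
  -- `mul_rpow_lintegral_le` asks for a lower bound which is at most `1`.
  set c := min c₀ 1 with hcdef
  have hc0 : c ≠ 0 := by simp [hcdef, hc₀]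
  have hcT : c ≠ ⊤ := ((min_le_right c₀ 1).trans_lt ENNReal.one_lt_top).ne
  set M := 2 / (1 - R / 8) with hM
  have hM0 : 0 < M := div_pos two_pos (by linarith)
  set C₂ := ENNReal.ofReal (M ^ |b| * M ^ |-(a + b + 2)|) with hC₂
  have hC₂T : C₂ ≠ ⊤ := ENNReal.ofReal_ne_top
  have hk : ∀ z ∈ disk, ∀ w ∈ disk, ∀ u ∈ disk, pseudoDist w u < R / 8 →
      ENNReal.ofReal (kernelK a b z w) ≤ C₂ * ENNReal.ofReal (kernelK a b z u) := by
    intro z hz w hw u hu h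
    rw [hC₂, ← ENNReal.ofReal_mul (by positivity)]
    exact ENNReal.ofReal_le_ofReal (kernelK_le_right (by linarith) hz hw hu h)
  have hT : ∀ x : ENNReal, x ≠ ⊤ → x ^ p ≠ ⊤ := fun x hx => ENNReal.rpow_ne_top_of_nonneg hp0.le hx
  refine ⟨(C₁ * C₂) ^ p * (c⁻¹ * C₂ ^ p), ENNReal.mul_ne_top (hT _ (ENNReal.mul_ne_top hC₁ hC₂T))
    (ENNReal.mul_ne_top (ENNReal.inv_ne_top.2 hc0) (hT _ hC₂T)), fun F hF z hz => ?_⟩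
  set k : ℂ → ENNReal := fun u => ENNReal.ofReal (kernelK a b z u) with hkdef
  have hkm : Measurable k :=
    ((measurable_kernelK a b).comp measurable_prodMk_left).ennreal_ofReal
  have s1 : opK a b F z ≤ C₁ * C₂ *
      ∫⁻ u, k u * ∫⁻ w in pseudoDisk (R / 8) u, F w ∂area ∂invArea := by
    refine (h₁ _ (hkm.mul hF)).trans ?_
    rw [mul_assoc, ← lintegral_const_mul' _ _ hC₂T]
    gcongr 1
    refine lintegral_mono_ae ?_
    filter_upwards [ae_invArea_mem_disk] with u hu
    rw [← mul_assoc, ← lintegral_const_mul' _ _ (ENNReal.mul_ne_top hC₂T ENNReal.ofReal_ne_top)]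
    refine setLIntegral_mono' (measurableSet_pseudoDisk _ _) fun w hw => ?_
    exact mul_le_mul' (hk z hz w hw.1 u hu (by rw [pseudoDist_comm]; exact hw.2)) le_rfl
  have s2 : c * (∫⁻ u, k u * ∫⁻ w in pseudoDisk (R / 8) u, F w ∂area ∂invArea) ^ p ≤
      ∫⁻ u, (C₂ * (k u * ∫⁻ w in pseudoDisk R u, F w ∂area)) ^ p ∂invArea := by
    refine mul_rpow_lintegral_le (E := pseudoDisk (R / 8)) hp0 hp1 hc0 (min_le_right _ _)
      (measurableSet_pseudoDisk _) ?_
    filter_upwards [ae_invArea_mem_disk] with u hu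
    refine ⟨(min_le_left _ _).trans (hc u hu), self_mem_pseudoDisk (by linarith) hu, fun v hv => ?_⟩
    rw [← mul_assoc]
    gcongr 1
    · exact hk z hz u hu v hv.1 hv.2
    · refine lintegral_mono_set fun w hw => ⟨hw.1, ?_⟩
      exact pseudoDist_lt_of_lt_div_eight hR1 hu hv.1 hw.1 hw.2 hv.2
  rw [mul_comm, ← ENNReal.le_div_iff_mul_le (Or.inl hc0) (Or.inl hcT),
    ENNReal.div_eq_inv_mul] at s2
  calc opK a b F z ^ p
      ≤ (C₁ * C₂ * ∫⁻ u, k u * ∫⁻ w in pseudoDisk (R / 8) u, F w ∂area ∂invArea) ^ p := by gcongr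
    _ = (C₁ * C₂) ^ p *
          (∫⁻ u, k u * ∫⁻ w in pseudoDisk (R / 8) u, F w ∂area ∂invArea) ^ p :=
        ENNReal.mul_rpow_of_nonneg _ _ hp0.le
    _ ≤ (C₁ * C₂) ^ p * (c⁻¹ *
          ∫⁻ u, (C₂ * (k u * ∫⁻ w in pseudoDisk R u, F w ∂area)) ^ p ∂invArea) := by gcongr
    _ = _ := by
        simp_rw [ENNReal.mul_rpow_of_nonneg C₂ _ hp0.le]
        rw [lintegral_const_mul' _ _ (hT _ hC₂T), mul_assoc, mul_assoc]

/-- The operator with kernel `K` is bounded from the space of functions whose averages over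
pseudohyperbolic disks are in `L^p` into `L^p`. -/
lemma exists_lintegral_opK_rpow_le {a b p R : ℝ} (hR0 : 0 < R) (hR1 : R < 1) (hp0 : 0 < p)
    (hp1 : p ≤ 1) (ha : -1 < a * p) (hb : 2 < (b + 2) * p) :
    ∃ C : ENNReal, C ≠ ⊤ ∧ ∀ F : ℂ → ENNReal, Measurable F →
      ∫⁻ z, opK a b F z ^ p ∂area ≤ C * ∫⁻ u, average R F u ^ p ∂area := by
  obtain ⟨C₁, hC₁, h₁⟩ := exists_opK_rpow_le (a := a) (b := b) hR0 hR1 hp0 hp1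
  obtain ⟨C₂, hC₂, h₂⟩ := exists_lintegral_kernelK_rpow_le hp0 ha hb
  obtain ⟨C₃, hC₃, h₃⟩ := exists_le_inv_area_pseudoDisk hR0 hR1
  have hC₃p : C₃ ^ p ≠ ⊤ := ENNReal.rpow_ne_top_of_nonneg hp0.le hC₃
  refine ⟨C₁ * (C₂ * C₃ ^ p), ENNReal.mul_ne_top hC₁ (ENNReal.mul_ne_top hC₂ hC₃p),
    fun F hF => ?_⟩
  set m : ℂ → ENNReal := fun u => ∫⁻ w in pseudoDisk R u, F w ∂area with hm
  have hmm : Measurable m :=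
    measurable_setLIntegral_pseudoDisk R (F := fun _ w => F w) (hF.comp measurable_snd)
  have hKm : Measurable fun x : ℂ × ℂ => ENNReal.ofReal (kernelK a b x.1 x.2) :=
    (measurable_kernelK a b).ennreal_ofReal
  calc ∫⁻ z, opK a b F z ^ p ∂area
      ≤ ∫⁻ z, C₁ * ∫⁻ u, (ENNReal.ofReal (kernelK a b z u) * m u) ^ p ∂invArea ∂area := by
        refine lintegral_mono_ae ?_
        filter_upwards [ae_mem_disk] with z hz using h₁ F hF z hz
    _ = C₁ * ∫⁻ u, ∫⁻ z, (ENNReal.ofReal (kernelK a b z u) * m u) ^ p ∂area ∂invArea := by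
        rw [lintegral_const_mul' _ _ hC₁, lintegral_lintegral_swap]
        exact ((hKm.mul (hmm.comp measurable_snd)).pow_const p).aemeasurable
    _ ≤ C₁ * ∫⁻ u, C₂ * C₃ ^ p * average R F u ^ p ∂area := by
        rw [lintegral_invArea]
        gcongr 1
        refine lintegral_mono_ae ?_
        filter_upwards [ae_mem_disk] with u hu
        have hd := defect_pos hu
        have e : ∫⁻ z, (ENNReal.ofReal (kernelK a b z u) * m u) ^ p ∂area ≤
            C₂ * ENNReal.ofReal (defect u ^ (2 - 2 * p)) * m u ^ p := by
          simp_rw [ENNReal.mul_rpow_of_nonneg _ _ hp0.le]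
          have hKu : Measurable fun z => ENNReal.ofReal (kernelK a b z u) :=
            ((measurable_kernelK a b).of_uncurry_right (y := u)).ennreal_ofReal
          rw [lintegral_mul_const _ (hKu.pow_const p)]
          gcongr
          exact h₂ u hu
        calc _ ≤ ENNReal.ofReal (defect u ^ (-2 : ℝ)) *
              (C₂ * ENNReal.ofReal (defect u ^ (2 - 2 * p)) * m u ^ p) := by gcongr
          _ = C₂ * (ENNReal.ofReal (defect u ^ (-2 : ℝ)) * m u) ^ p := by
              rw [ENNReal.mul_rpow_of_nonneg _ _ hp0.le,
                ENNReal.ofReal_rpow_of_nonneg (by positivity) hp0.le, ← Real.rpow_mul hd.le,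
                show (-2 : ℝ) * p = -2 + (2 - 2 * p) by ring, Real.rpow_add hd,
                ENNReal.ofReal_mul (by positivity)]
              ring
          _ ≤ C₂ * (C₃ * (area (pseudoDisk R u))⁻¹ * m u) ^ p := by gcongr; exact h₃ u hu
          _ = _ := by
              rw [mul_assoc C₃, ENNReal.mul_rpow_of_nonneg C₃ _ hp0.le, mul_assoc C₂]; rfl
    _ = _ := by
        rw [lintegral_const_mul' _ _ (ENNReal.mul_ne_top hC₂ hC₃p), ← mul_assoc]

/-! ### Averages over pseudohyperbolic disks -/

/-- Jensen's inequality for the measure with density `G`. -/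
lemma lintegral_mul_rpow_le {X : Type*} [MeasurableSpace X] {μ : Measure X} {F G : X → ENNReal}
    {q : ℝ} (hq : 1 ≤ q) (hF : Measurable F) (hG : Measurable G) :
    (∫⁻ x, G x * F x ∂μ) ^ q ≤ (∫⁻ x, G x ∂μ) ^ (q - 1) * ∫⁻ x, G x * F x ^ q ∂μ := by
  have hq0 : 0 < q := by linarith
  have h := eLpNorm'_le_eLpNorm'_mul_rpow_measure_univ (μ := μ.withDensity G) zero_lt_one hq
    hF.aestronglyMeasurable
  simp only [eLpNorm', enorm_eq_self, ENNReal.rpow_one, div_one] at h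
  rw [lintegral_withDensity_eq_lintegral_mul _ hG hF,
    lintegral_withDensity_eq_lintegral_mul _ hG (hF.pow_const q),
    withDensity_apply _ MeasurableSet.univ, Measure.restrict_univ] at h
  have h' := ENNReal.rpow_le_rpow h hq0.le
  rw [ENNReal.mul_rpow_of_nonneg _ _ hq0.le, ← ENNReal.rpow_mul, ← ENNReal.rpow_mul,
    one_div_mul_cancel hq0.ne', ENNReal.rpow_one, sub_mul, one_div_mul_cancel hq0.ne', one_mul]
    at h'
  rw [mul_comm (_ ^ (q - 1))]
  exact h'

lemma area_pseudoDisk_ne_zero {R : ℝ} (hR0 : 0 < R) (hR1 : R < 1) {z : ℂ} (hz : z ∈ disk) :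
    area (pseudoDisk R z) ≠ 0 := by
  refine (lt_of_lt_of_le ?_ (le_area_pseudoDisk hR0 hR1 hz)).ne'
  rw [ENNReal.ofReal_pos]
  have := defect_pos hz
  have := Real.pi_pos
  positivity

lemma area_pseudoDisk_ne_top {R : ℝ} (hR0 : 0 < R) (hR1 : R < 1) {z : ℂ} (hz : z ∈ disk) :
    area (pseudoDisk R z) ≠ ⊤ :=
  ((area_pseudoDisk_le hR0 hR1 hz).trans_lt ENNReal.ofReal_lt_top).ne

lemma average_mono {R : ℝ} {F G : ℂ → ENNReal} {z : ℂ} (h : ∀ w ∈ pseudoDisk R z, F w ≤ G w) :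
    average R F z ≤ average R G z := by
  unfold average
  gcongr 1
  exact setLIntegral_mono' (measurableSet_pseudoDisk R z) h

lemma average_le_of_forall_le {R : ℝ} (hR0 : 0 < R) (hR1 : R < 1) {F : ℂ → ENNReal} {z : ℂ}
    (hz : z ∈ disk) {c : ENNReal} (h : ∀ w ∈ pseudoDisk R z, F w ≤ c) : average R F z ≤ c := by
  refine (average_mono (G := fun _ => c) h).trans (le_of_eq ?_)
  rw [average, setLIntegral_const, mul_comm c, ← mul_assoc, ENNReal.inv_mul_cancel
    (area_pseudoDisk_ne_zero hR0 hR1 hz) (area_pseudoDisk_ne_top hR0 hR1 hz), one_mul]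

lemma average_const_mul (R : ℝ) (F : ℂ → ENNReal) (z : ℂ) {c : ENNReal} (hc : c ≠ ⊤) :
    average R (fun w => c * F w) z = c * average R F z := by
  rw [average, average, lintegral_const_mul' _ _ hc]; ring

lemma average_add (R : ℝ) {F : ℂ → ENNReal} (hF : Measurable F) (G : ℂ → ENNReal) (z : ℂ) :
    average R (fun w => F w + G w) z = average R F z + average R G z := by
  rw [average, average, average, lintegral_add_left hF, mul_add]

lemma average_rpow_le {R q : ℝ} (hR0 : 0 < R) (hR1 : R < 1) (hq : 1 ≤ q) {F : ℂ → ENNReal}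
    (hF : Measurable F) {z : ℂ} (hz : z ∈ disk) :
    average R F z ^ q ≤ average R (fun w => F w ^ q) z := by
  have h0 := area_pseudoDisk_ne_zero hR0 hR1 hz
  have hT := area_pseudoDisk_ne_top hR0 hR1 hz
  have h := lintegral_mul_rpow_le (μ := area.restrict (pseudoDisk R z))
    (G := fun _ => (area (pseudoDisk R z))⁻¹) hq hF measurable_const
  have e1 := ENNReal.inv_ne_top.2 h0
  rwa [lintegral_const_mul' _ _ e1, lintegral_const_mul' _ _ e1, setLIntegral_const,
    ENNReal.inv_mul_cancel h0 hT, ENNReal.one_rpow, one_mul] at h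

lemma measurable_average (R : ℝ) {F : ℂ → ENNReal} (hF : Measurable F) :
    Measurable (average R F) := by
  have h1 := measurable_setLIntegral_pseudoDisk R (F := fun _ w => F w) (hF.comp measurable_snd)
  have h2 := measurable_setLIntegral_pseudoDisk R (F := fun _ _ => 1) measurable_const
  simp only [setLIntegral_one] at h2
  exact h2.inv.mul h1

/-- The set where `G = ∞` meets almost every pseudohyperbolic disk in a null set, hence is null by
the covering inequality applied to its indicator. -/
lemma ae_lt_top_of_ae_average_lt_top {R : ℝ} (hR0 : 0 < R) (hR1 : R < 1) {G : ℂ → ENNReal}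
    (hG : Measurable G) (h : ∀ᵐ z ∂area, average R G z < ⊤) : ∀ᵐ z ∂area, G z < ⊤ := by
  obtain ⟨C, -, hC⟩ := exists_lintegral_le_lintegral_setLIntegral hR0 hR1
  have hm : MeasurableSet {w | G w = ⊤} := hG (measurableSet_singleton ⊤)
  have h1 := hC ({w | G w = ⊤}.indicator 1) (measurable_one.indicator hm)
  have h2 : ∫⁻ u, ∫⁻ w in pseudoDisk R u, {w | G w = ⊤}.indicator 1 w ∂area ∂invArea = 0 := by
    refine lintegral_eq_zero_of_ae_eq_zero ?_
    have h' : ∀ᵐ z ∂invArea, average R G z < ⊤ := (withDensity_absolutelyContinuous _ _).ae_le h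
    filter_upwards [h', ae_invArea_mem_disk] with z hz hzd
    refine lintegral_eq_zero_of_ae_eq_zero ?_
    have hz' : ∫⁻ w in pseudoDisk R z, G w ∂area ≠ ⊤ := by
      intro hcon
      rw [average, hcon, ENNReal.mul_top
        (ENNReal.inv_ne_zero.2 (area_pseudoDisk_ne_top hR0 hR1 hzd))] at hz
      exact hz.ne rfl
    filter_upwards [ae_lt_top hG hz'] with w hw
    exact Set.indicator_of_notMem (by simpa using hw.ne) _
  rw [h2, mul_zero, lintegral_indicator_one hm] at h1
  rw [ae_iff]
  simpa using h1

/-! ### From bounds on averages to bounded operators -/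

lemma measurable_lintegral_kernel_mul {T : ℂ → ℂ → ENNReal} (hT : Measurable (Function.uncurry T))
    {F : ℂ → ENNReal} (hF : Measurable F) : Measurable fun z => ∫⁻ w, T z w * F w ∂area :=
  (hT.mul (hF.comp measurable_snd)).lintegral_prod_right'

lemma measurable_opK (a b : ℝ) {F : ℂ → ENNReal} (hF : Measurable F) : Measurable (opK a b F) :=
  measurable_lintegral_kernel_mul (T := fun z w => ENNReal.ofReal (kernelK a b z w))
    (measurable_kernelK a b).ennreal_ofReal hF

lemma lpqNorm_eq (R p q : ℝ) (f : ℂ → ℂ) :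
    lpqNorm R p q f = (∫⁻ z, average R (fun w => ‖f w‖ₑ ^ q) z ^ (p / q) ∂area) ^ (1 / p) := by
  simp_rw [lpqNorm, localMean_eq, ← ENNReal.rpow_mul, one_div_mul_eq_div]

/-- The averages of `(T F) ^ q` are to be controlled by two operators of the type `K`: one of them
acts on `F`, the other acts on `F ^ q` and is used with the exponent `p / q`. Its parameters `0` and
`2 q / p` are admissible for this exponent; the second one only has to be large. -/
lemma definesBoundedOperator_of_average_le {R p q a b : ℝ} (hR0 : 0 < R) (hR1 : R < 1)
    (hp0 : 0 < p) (hp1 : p < 1) (hq : 1 ≤ q) (ha : -1 < a * p) (hb : 2 < (b + 2) * p)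
    {T : ℂ → ℂ → ℝ} (hT : Measurable (Function.uncurry T))
    (h : ∃ C : ENNReal, C ≠ ⊤ ∧ ∀ F : ℂ → ENNReal, Measurable F → ∀ z ∈ disk,
      average R (fun z => (∫⁻ w, ‖T z w‖ₑ * F w ∂area) ^ q) z ≤
        C * (opK a b F z ^ q + opK 0 (2 * q / p) (fun w => F w ^ q) z)) :
    DefinesBoundedOperator R p q T := by
  have hq0 : 0 < q := by linarith
  have hpq0 : 0 < p / q := div_pos hp0 hq0
  have hpq1 : p / q ≤ 1 := by rw [div_le_one hq0]; linarith
  obtain ⟨C, hC, hTC⟩ := h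
  obtain ⟨C₁, hC₁, h₁⟩ := exists_lintegral_opK_rpow_le hR0 hR1 hp0 hp1.le ha hb
  obtain ⟨C₂, hC₂, h₂⟩ := exists_lintegral_opK_rpow_le (a := 0) (b := 2 * q / p) hR0 hR1 hpq0 hpq1
    (by simp) (by
      rw [add_mul]
      have : 2 * q / p * (p / q) = 2 := by field_simp
      linarith)
  have hCp : C ^ (p / q) ≠ ⊤ := ENNReal.rpow_ne_top_of_nonneg hpq0.le hC
  set C₃ := C ^ (p / q) * (C₁ + C₂) with hC₃def
  have hC₃ : C₃ ≠ ⊤ := ENNReal.mul_ne_top hCp (ENNReal.add_ne_top.2 ⟨hC₁, hC₂⟩)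
  set A : (ℂ → ENNReal) → ℂ → ENNReal := fun F z => ∫⁻ w, ‖T z w‖ₑ * F w ∂area with hA
  have key : ∀ F : ℂ → ENNReal, Measurable F →
      ∫⁻ z, average R (fun w => A F w ^ q) z ^ (p / q) ∂area ≤
        C₃ * ∫⁻ z, average R (fun w => F w ^ q) z ^ (p / q) ∂area := by
    intro F hF
    calc ∫⁻ z, average R (fun w => A F w ^ q) z ^ (p / q) ∂area
        ≤ ∫⁻ z, C ^ (p / q) * (opK a b F z ^ p +
            opK 0 (2 * q / p) (fun w => F w ^ q) z ^ (p / q)) ∂area := by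
          refine lintegral_mono_ae ?_
          filter_upwards [ae_mem_disk] with z hz
          calc _ ≤ (C * (opK a b F z ^ q + opK 0 (2 * q / p) (fun w => F w ^ q) z)) ^ (p / q) := by
                gcongr; exact hTC F hF z hz
            _ ≤ C ^ (p / q) * ((opK a b F z ^ q) ^ (p / q) +
                  opK 0 (2 * q / p) (fun w => F w ^ q) z ^ (p / q)) := by
                rw [ENNReal.mul_rpow_of_nonneg _ _ hpq0.le]
                gcongr
                exact ENNReal.rpow_add_le_add_rpow _ _ hpq0.le hpq1
            _ = _ := by rw [← ENNReal.rpow_mul, mul_div_cancel₀ _ hq0.ne']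
      _ = C ^ (p / q) * (∫⁻ z, opK a b F z ^ p ∂area +
            ∫⁻ z, opK 0 (2 * q / p) (fun w => F w ^ q) z ^ (p / q) ∂area) := by
          rw [lintegral_const_mul' _ _ hCp,
            lintegral_add_left ((measurable_opK a b hF).pow_const p)]
      _ ≤ C ^ (p / q) * (C₁ * ∫⁻ z, average R (fun w => F w ^ q) z ^ (p / q) ∂area +
            C₂ * ∫⁻ z, average R (fun w => F w ^ q) z ^ (p / q) ∂area) := by
          gcongr
          · refine (h₁ F hF).trans ?_
            gcongr 1
            refine lintegral_mono_ae ?_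
            filter_upwards [ae_mem_disk] with z hz
            calc average R F z ^ p = (average R F z ^ q) ^ (p / q) := by
                  rw [← ENNReal.rpow_mul, mul_div_cancel₀ _ hq0.ne']
              _ ≤ _ := by gcongr; exact average_rpow_le hR0 hR1 hq hF hz
          · exact h₂ _ (hF.pow_const q)
      _ = _ := by rw [← add_mul, hC₃def, mul_assoc]
  refine ⟨(C₃ ^ (1 / p)).toNNReal, fun f ⟨hf, hfn⟩ => ?_⟩
  rw [ENNReal.coe_toNNReal (ENNReal.rpow_ne_top_of_nonneg (by positivity) hC₃)]
  -- A measurable representative of `f`.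
  set f' := hf.mk f with hf'
  have hff' : f =ᵐ[area] f' := hf.ae_eq_mk
  have hf'm : Measurable f' := hf.measurable_mk
  set F : ℂ → ENNReal := fun w => ‖f' w‖ₑ with hF
  have hFm : Measurable F := hf'm.enorm
  have hav : ∀ z, average R (fun w => ‖f w‖ₑ ^ q) z = average R (fun w => F w ^ q) z := by
    intro z
    unfold average
    congr 1
    refine lintegral_congr_ae (ae_restrict_of_ae ?_)
    filter_upwards [hff'] with w hw
    rw [hF, hw]
  have hnorm : lpqNorm R p q f =
      (∫⁻ z, average R (fun w => F w ^ q) z ^ (p / q) ∂area) ^ (1 / p) := by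
    simp_rw [lpqNorm_eq, hav]
  have hfin : ∫⁻ z, average R (fun w => F w ^ q) z ^ (p / q) ∂area ≠ ⊤ := by
    rw [hnorm, ENNReal.rpow_lt_top_iff_of_pos (by positivity)] at hfn
    exact hfn.ne
  have hAe : ∀ z, ∫⁻ w, ‖(T z w : ℂ) * f w‖ₑ ∂area = A F z := by
    intro z
    refine lintegral_congr_ae ?_
    filter_upwards [hff'] with w hw
    rw [enorm_mul, hw, ← ofReal_norm, Complex.norm_real, ofReal_norm]
  have hAm : Measurable (A F) :=
    measurable_lintegral_kernel_mul (T := fun z w => ‖T z w‖ₑ) hT.enorm hFm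
  have hle : lpqNorm R p q (integralOp T f) ≤ C₃ ^ (1 / p) * lpqNorm R p q f := by
    rw [hnorm, lpqNorm_eq, ← ENNReal.mul_rpow_of_nonneg _ _ (by positivity)]
    gcongr 1
    refine le_trans (lintegral_mono fun z => ?_) (key F hFm)
    gcongr 1
    refine average_mono fun w _ => ?_
    gcongr 1
    rw [← hAe]
    exact enorm_integral_le_lintegral_enorm _
  have hmeas : AEMeasurable (integralOp T f) area := by
    have e : integralOp T f = fun z => ∫ w, (T z w : ℂ) * f' w ∂area := by
      ext z
      refine integral_congr_ae ?_
      filter_upwards [hff'] with w hw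
      rw [hw]
    rw [e]
    have hm : Measurable fun x : ℂ × ℂ => (T x.1 x.2 : ℂ) * f' x.2 :=
      (Complex.measurable_ofReal.comp hT).mul (hf'm.comp measurable_snd)
    exact hm.stronglyMeasurable.integral_prod_right'.measurable.aemeasurable
  refine ⟨?_, ⟨hmeas, hle.trans_lt (ENNReal.mul_lt_top
    (ENNReal.rpow_ne_top_of_nonneg (by positivity) hC₃).lt_top hfn)⟩, hle⟩
  have hA1 : ∀ᵐ z ∂area, average R (fun w => A F w ^ q) z < ⊤ := by
    have hm := (measurable_average R (hAm.pow_const q)).pow_const (p / q)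
    have hne := ((key F hFm).trans_lt (ENNReal.mul_lt_top hC₃.lt_top hfin.lt_top)).ne
    filter_upwards [ae_lt_top hm hne] with z hz
    rwa [ENNReal.rpow_lt_top_iff_of_pos hpq0] at hz
  filter_upwards [ae_lt_top_of_ae_average_lt_top hR0 hR1 (hAm.pow_const q) hA1] with z hz
  rw [ENNReal.rpow_lt_top_iff_of_pos hq0] at hz
  refine ⟨?_, ?_⟩
  · exact (Complex.measurable_ofReal.comp (hT.of_uncurry_left (x := z))).aestronglyMeasurable.mul
      hf.aestronglyMeasurable
  · rw [HasFiniteIntegral, hAe]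
    exact hz

/-! ### The averages of the two operators -/

/-- The function `opK a b F` is essentially constant on pseudohyperbolic disks. -/
lemma exists_average_opK_rpow_le {R : ℝ} (a b : ℝ) {q : ℝ} (hR0 : 0 < R) (hR1 : R < 1)
    (hq : 0 ≤ q) :
    ∃ C : ENNReal, C ≠ ⊤ ∧ ∀ F : ℂ → ENNReal, ∀ z ∈ disk,
      average R (fun z => opK a b F z ^ q) z ≤ C * opK a b F z ^ q := by
  have hM0 : 0 < 2 / (1 - R) := div_pos two_pos (by linarith)
  set M := 2 / (1 - R) with hM
  refine ⟨ENNReal.ofReal (M ^ |a| * M ^ |-(a + b + 2)|) ^ q,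
    ENNReal.rpow_ne_top_of_nonneg hq ENNReal.ofReal_ne_top, fun F z hz => ?_⟩
  refine average_le_of_forall_le hR0 hR1 hz fun u hu => ?_
  rw [← ENNReal.mul_rpow_of_nonneg _ _ hq, opK, opK,
    ← lintegral_const_mul' _ _ ENNReal.ofReal_ne_top]
  gcongr 1
  refine lintegral_mono_ae ?_
  filter_upwards [ae_mem_disk] with w hw
  rw [← mul_assoc, ← ENNReal.ofReal_mul (by positivity)]
  gcongr
  exact kernelK_le_left hR1 hu.1 hw hz (by rw [pseudoDist_comm]; exact hu.2)

lemma measurable_kernelB (a b : ℝ) : Measurable (Function.uncurry (kernelB a b)) := by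
  have := measurable_star_snd
  unfold Function.uncurry kernelB
  fun_prop

lemma kernelB_nonneg (a b : ℝ) {z w : ℂ} (hz : z ∈ disk) (hw : w ∈ disk) :
    0 ≤ kernelB a b z w := by
  have h1 := defect_pos hz
  have h2 := defect_pos hw
  unfold defect at h1 h2
  unfold kernelB; positivity

lemma kernelB_eq (a b : ℝ) (z w : ℂ) : kernelB a b z w =
    defect z ^ a * defect w ^ b * ‖1 - star w * z‖ ^ (-(a + b + 1)) * ‖z - w‖⁻¹ := by
  rw [Real.rpow_neg (norm_nonneg _), mul_assoc, ← mul_inv, mul_comm (‖1 - star w * z‖ ^ _),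
    ← div_eq_mul_inv]
  rfl

/-- Away from the diagonal, `B` is dominated by `K`. -/
lemma kernelB_le_of_le_pseudoDist {a b R : ℝ} (hR0 : 0 < R) {z w : ℂ} (hz : z ∈ disk)
    (hw : w ∈ disk) (h : R ≤ pseudoDist z w) : kernelB a b z w ≤ R⁻¹ * kernelK a b z w := by
  have h1 := defect_pos hz
  have h2 := defect_pos hw
  have hN := norm_one_sub_star_mul_pos hz hw
  have h3 : R * ‖1 - star w * z‖ ≤ ‖z - w‖ := by
    rwa [← not_lt, ← pseudoDist_lt_iff hz hw, not_lt]
  have h4 : ‖z - w‖⁻¹ ≤ R⁻¹ * ‖1 - star w * z‖ ^ (-1 : ℝ) := by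
    rw [Real.rpow_neg_one, ← mul_inv]
    exact inv_anti₀ (by positivity) h3
  rw [kernelB_eq, kernelK_eq, show -(a + b + 2) = -(a + b + 1) + -1 by ring, Real.rpow_add hN]
  calc _ ≤ defect z ^ a * defect w ^ b * ‖1 - star w * z‖ ^ (-(a + b + 1)) *
        (R⁻¹ * ‖1 - star w * z‖ ^ (-1 : ℝ)) := by gcongr
    _ = _ := by ring

/-- Near the diagonal, `B` has the size of `1 / ((1 - |z|²) |z - w|)`. -/
lemma kernelB_le_of_pseudoDist_lt {a b R : ℝ} (hR1 : R < 1) {z w : ℂ} (hz : z ∈ disk)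
    (hw : w ∈ disk) (h : pseudoDist z w < R) :
    kernelB a b z w ≤ (2 / (1 - R)) ^ |b| * (2 / (1 - R)) ^ |-(a + b + 1)| *
      ((defect z)⁻¹ * ‖z - w‖⁻¹) := by
  have h1 := defect_pos hz
  have h2 := defect_pos hw
  have hM0 : 0 < 2 / (1 - R) := div_pos two_pos (by linarith)
  have b1 := (comparable_defect hR1 hz hw h).symm.rpow_le b
  have b2 := (comparable_norm_defect hR1 hz hw h).rpow_le (-(a + b + 1))
  have e : (defect z)⁻¹ = defect z ^ a * defect z ^ b * defect z ^ (-(a + b + 1)) := by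
    rw [← Real.rpow_add h1, ← Real.rpow_add h1, ← Real.rpow_neg_one]
    congr 1; ring
  rw [kernelB_eq, e]
  calc _ ≤ defect z ^ a * ((2 / (1 - R)) ^ |b| * defect z ^ b) *
        ((2 / (1 - R)) ^ |-(a + b + 1)| * defect z ^ (-(a + b + 1))) * ‖z - w‖⁻¹ := by gcongr
    _ = _ := by ring

/-- The part of the kernel `B` near the diagonal. -/
noncomputable def nearKernel (a b R : ℝ) (z w : ℂ) : ENNReal :=
  {x : ℂ × ℂ | x.2 ∈ pseudoDisk R x.1}.indicator (fun x => ‖kernelB a b x.1 x.2‖ₑ) (z, w)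

lemma measurable_nearKernel (a b R : ℝ) : Measurable (Function.uncurry (nearKernel a b R)) :=
  (measurable_kernelB a b).enorm.indicator (measurableSet_pseudoDisk_prod R)

lemma lintegral_pseudoDisk_inv_norm_le {R : ℝ} (hR0 : 0 < R) (hR1 : R < 1) {z : ℂ}
    (hz : z ∈ disk) :
    ∫⁻ w in pseudoDisk R z, ENNReal.ofReal ((defect z)⁻¹ * ‖z - w‖⁻¹) ∂area ≤
      ENNReal.ofReal (2 * Real.pi / (1 - R)) := by
  have hd := defect_pos hz
  simp_rw [ENNReal.ofReal_mul (inv_nonneg.2 hd.le)]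
  rw [lintegral_const_mul' _ _ ENNReal.ofReal_ne_top, area,
    Measure.restrict_restrict (measurableSet_pseudoDisk R z),
    Set.inter_eq_left.2 (pseudoDisk_subset_disk R z)]
  calc _ ≤ ENNReal.ofReal (defect z)⁻¹ *
        ∫⁻ w in Metric.ball z (defect z / (1 - R)), ENNReal.ofReal ‖z - w‖⁻¹ := by
        gcongr 1
        exact lintegral_mono_set (pseudoDisk_subset_ball hR0 hR1 hz)
    _ ≤ ENNReal.ofReal (defect z)⁻¹ * ENNReal.ofReal (2 * Real.pi * (defect z / (1 - R))) := by
        gcongr 1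
        exact lintegral_ball_inv_norm_le _ _
    _ = _ := by
        rw [← ENNReal.ofReal_mul (by positivity)]
        congr 1; field_simp

/-- Both marginals of the part of `B` near the diagonal are bounded, as in Schur's test. -/
lemma exists_lintegral_nearKernel_le (a b : ℝ) {R : ℝ} (hR0 : 0 < R) (hR1 : R < 1) :
    ∃ C : ENNReal, C ≠ ⊤ ∧ (∀ z ∈ disk, ∫⁻ w, nearKernel a b R z w ∂area ≤ C) ∧
      ∀ w ∈ disk, ∫⁻ z, nearKernel a b R z w ∂area ≤ C := by
  have hM0 : 0 < 2 / (1 - R) := div_pos two_pos (by linarith)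
  set M := 2 / (1 - R) with hM
  set B := M ^ |b| * M ^ |-(a + b + 1)| with hB
  have hB0 : 0 < B := by positivity
  have hpt : ∀ z ∈ disk, ∀ w ∈ pseudoDisk R z, nearKernel a b R z w ≤
      ENNReal.ofReal B * ENNReal.ofReal ((defect z)⁻¹ * ‖z - w‖⁻¹) := by
    intro z hz w hw
    rw [nearKernel, Set.indicator_of_mem (by exact hw), ← ENNReal.ofReal_mul hB0.le,
      Real.enorm_of_nonneg (kernelB_nonneg a b hz hw.1)]
    exact ENNReal.ofReal_le_ofReal (kernelB_le_of_pseudoDist_lt hR1 hz hw.1 hw.2)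
  refine ⟨ENNReal.ofReal B * ENNReal.ofReal (2 * Real.pi / (1 - R)) +
    ENNReal.ofReal (B * M) * ENNReal.ofReal (2 * Real.pi / (1 - R)), by finiteness,
    fun z hz => le_add_right ?_, fun w hw => le_add_left ?_⟩
  · calc ∫⁻ w, nearKernel a b R z w ∂area
        ≤ ∫⁻ w in pseudoDisk R z,
            ENNReal.ofReal B * ENNReal.ofReal ((defect z)⁻¹ * ‖z - w‖⁻¹) ∂area := by
          rw [← lintegral_indicator (measurableSet_pseudoDisk R z)]
          refine lintegral_mono fun w => ?_
          by_cases hw : w ∈ pseudoDisk R z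
          · rw [Set.indicator_of_mem hw]
            exact hpt z hz w hw
          · rw [nearKernel, Set.indicator_of_notMem (by exact hw)]
            exact zero_le
      _ ≤ _ := by
          rw [lintegral_const_mul' _ _ ENNReal.ofReal_ne_top]
          gcongr
          exact lintegral_pseudoDisk_inv_norm_le hR0 hR1 hz
  · calc ∫⁻ z, nearKernel a b R z w ∂area
        ≤ ∫⁻ z in pseudoDisk R w,
            ENNReal.ofReal (B * M) * ENNReal.ofReal ((defect w)⁻¹ * ‖w - z‖⁻¹) ∂area := by
          rw [← lintegral_indicator (measurableSet_pseudoDisk R w)]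
          refine lintegral_mono_ae ?_
          filter_upwards [ae_mem_disk] with z hz
          by_cases hzw : w ∈ pseudoDisk R z
          · rw [Set.indicator_of_mem ((mem_pseudoDisk_comm hz hw).1 hzw)]
            refine (hpt z hz w hzw).trans ?_
            rw [← ENNReal.ofReal_mul hB0.le, ← ENNReal.ofReal_mul (by positivity), mul_assoc B]
            refine ENNReal.ofReal_le_ofReal ?_
            have hc := comparable_defect hR1 hz hw hzw.2
            have hdz := hc.left_pos
            have hdw := hc.right_pos
            have : (defect z)⁻¹ ≤ M * (defect w)⁻¹ := by
              rw [← div_eq_mul_inv, inv_eq_one_div, div_le_div_iff₀ hdz hdw, one_mul]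
              exact hc.le_left
            rw [norm_sub_rev w z, ← mul_assoc M]
            gcongr
          · rw [nearKernel, Set.indicator_of_notMem (by exact hzw)]
            exact zero_le
      _ ≤ _ := by
          rw [lintegral_const_mul' _ _ ENNReal.ofReal_ne_top]
          gcongr
          exact lintegral_pseudoDisk_inv_norm_le hR0 hR1 hw

/-- If `w` is close to a point `z` which is close to `z₀`, then the kernel `K` at `(z₀, w)` is at
least of the size `(1 - |z₀|²)⁻²`, whatever its parameters are. -/
lemma exists_defect_rpow_le_kernelK (a b : ℝ) {R : ℝ} (hR1 : R < 1) :
    ∃ C : ℝ, 0 < C ∧ ∀ z₀ ∈ disk, ∀ z ∈ pseudoDisk R z₀, ∀ w ∈ pseudoDisk R z,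
      defect z₀ ^ (-2 : ℝ) ≤ C * kernelK a b z₀ w := by
  have hM0 : 0 < 2 / (1 - R) := div_pos two_pos (by linarith)
  set M := 2 / (1 - R) with hM
  refine ⟨(M * M) ^ |b| * (M * (M * M)) ^ |-(a + b + 2)|, by positivity,
    fun z₀ hz₀ z hz w hw => ?_⟩
  have hd := comparable_defect hR1 hz₀ hz.1 hz.2
  have b1 := (hd.trans (comparable_defect hR1 hz.1 hw.1 hw.2)).rpow_le b
  have b2 := ((hd.trans (comparable_norm_defect hR1 hz.1 hw.1 hw.2).symm).trans
    (comparable_norm hR1 hz₀ hz.1 hw.1 hz.2).symm).rpow_le (-(a + b + 2))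
  rw [show M * M * M = M * (M * M) by ring] at b2
  have h1 := defect_pos hz₀
  have h2 := defect_pos hw.1
  have e : defect z₀ ^ (-2 : ℝ) =
      defect z₀ ^ a * defect z₀ ^ b * defect z₀ ^ (-(a + b + 2)) := by
    rw [← Real.rpow_add h1, ← Real.rpow_add h1]
    congr 1; ring
  rw [kernelK_eq, e]
  calc _ ≤ defect z₀ ^ a * ((M * M) ^ |b| * defect w ^ b) *
        ((M * (M * M)) ^ |-(a + b + 2)| * ‖1 - star w * z₀‖ ^ (-(a + b + 2))) := by gcongr
    _ = _ := by ring

/-- The averages of the part of `B` near the diagonal, by Jensen's inequality and Fubini's theorem.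
The parameters of `K` on the right are arbitrary. -/
lemma exists_average_nearKernel_rpow_le (a b a' b' : ℝ) {R q : ℝ} (hR0 : 0 < R) (hR1 : R < 1)
    (hq : 1 ≤ q) :
    ∃ C : ENNReal, C ≠ ⊤ ∧ ∀ F : ℂ → ENNReal, Measurable F → ∀ z ∈ disk,
      average R (fun z => (∫⁻ w, nearKernel a b R z w * F w ∂area) ^ q) z ≤
        C * opK a' b' (fun w => F w ^ q) z := by
  obtain ⟨C₁, hC₁, h₁, h₁'⟩ := exists_lintegral_nearKernel_le a b hR0 hR1
  obtain ⟨C₂, hC₂, h₂⟩ := exists_inv_area_pseudoDisk_le hR0 hR1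
  obtain ⟨C₃, hC₃, h₃⟩ := exists_defect_rpow_le_kernelK a' b' hR1
  have hC₁q : C₁ ^ (q - 1) ≠ ⊤ := ENNReal.rpow_ne_top_of_nonneg (by linarith) hC₁
  set C₄ := C₂ * ENNReal.ofReal C₃ with hC₄def
  have hC₄ : C₄ ≠ ⊤ := ENNReal.mul_ne_top hC₂ ENNReal.ofReal_ne_top
  refine ⟨C₁ ^ (q - 1) * (C₄ * C₁), ENNReal.mul_ne_top hC₁q (ENNReal.mul_ne_top hC₄ hC₁),
    fun F hF z₀ hz₀ => ?_⟩
  set k := nearKernel a b R with hk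
  have hkm : Measurable (Function.uncurry k) := measurable_nearKernel a b R
  have hFq : Measurable fun w => F w ^ q := hF.pow_const q
  have hKm : Measurable fun w => ENNReal.ofReal (kernelK a' b' z₀ w) :=
    ((measurable_kernelK a' b').of_uncurry_left (x := z₀)).ennreal_ofReal
  have hinv : (area (pseudoDisk R z₀))⁻¹ ≠ ⊤ :=
    ENNReal.inv_ne_top.2 (area_pseudoDisk_ne_zero hR0 hR1 hz₀)
  have hpt : ∀ z ∈ pseudoDisk R z₀, ∀ w, (area (pseudoDisk R z₀))⁻¹ * k z w ≤
      C₄ * ENNReal.ofReal (kernelK a' b' z₀ w) * k z w := by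
    intro z hz w
    by_cases hw : w ∈ pseudoDisk R z
    · gcongr
      refine (h₂ z₀ hz₀).trans ?_
      rw [hC₄def, mul_assoc, ← ENNReal.ofReal_mul hC₃.le]
      gcongr
      exact h₃ z₀ hz₀ z hz w hw
    · rw [hk, nearKernel, Set.indicator_of_notMem (by exact hw), mul_zero, mul_zero]
  calc average R (fun z => (∫⁻ w, k z w * F w ∂area) ^ q) z₀
      ≤ average R (fun z => C₁ ^ (q - 1) * ∫⁻ w, k z w * F w ^ q ∂area) z₀ := by
        refine average_mono fun z hz => ?_
        refine (lintegral_mul_rpow_le hq hF hkm.of_uncurry_left).trans ?_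
        exact mul_le_mul' (ENNReal.rpow_le_rpow (h₁ z hz.1) (by linarith)) le_rfl
    _ = C₁ ^ (q - 1) * ∫⁻ z in pseudoDisk R z₀, ∫⁻ w,
          (area (pseudoDisk R z₀))⁻¹ * k z w * F w ^ q ∂area ∂area := by
        rw [average_const_mul _ _ _ hC₁q, average, ← lintegral_const_mul' _ _ hinv]
        simp_rw [mul_assoc, lintegral_const_mul' _ _ hinv]
    _ ≤ C₁ ^ (q - 1) * ∫⁻ z in pseudoDisk R z₀, ∫⁻ w,
          C₄ * ENNReal.ofReal (kernelK a' b' z₀ w) * k z w * F w ^ q ∂area ∂area := by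
        gcongr 1
        refine setLIntegral_mono' (measurableSet_pseudoDisk R z₀) fun z hz => ?_
        exact lintegral_mono fun w => mul_le_mul' (hpt z hz w) le_rfl
    _ ≤ C₁ ^ (q - 1) * ∫⁻ z, ∫⁻ w,
          C₄ * ENNReal.ofReal (kernelK a' b' z₀ w) * k z w * F w ^ q ∂area ∂area := by
        gcongr 1
        exact setLIntegral_le_lintegral _ _
    _ = C₁ ^ (q - 1) * ∫⁻ w, ∫⁻ z,
          C₄ * ENNReal.ofReal (kernelK a' b' z₀ w) * k z w * F w ^ q ∂area ∂area := by
        rw [lintegral_lintegral_swap]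
        exact ((((hKm.comp measurable_snd).const_mul C₄).mul hkm).mul
          (hFq.comp measurable_snd)).aemeasurable
    _ ≤ C₁ ^ (q - 1) * ∫⁻ w, C₄ * C₁ * (ENNReal.ofReal (kernelK a' b' z₀ w) * F w ^ q) ∂area := by
        gcongr 1
        refine lintegral_mono_ae ?_
        filter_upwards [ae_mem_disk] with w hw
        have hkw : Measurable fun z => k z w := hkm.of_uncurry_right
        rw [lintegral_mul_const _ (hkw.const_mul _), lintegral_const_mul _ hkw]
        calc _ ≤ C₄ * ENNReal.ofReal (kernelK a' b' z₀ w) * C₁ * F w ^ q := by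
              gcongr; exact h₁' w hw
          _ = _ := by ring
    _ = _ := by
        rw [lintegral_const_mul' _ _ (ENNReal.mul_ne_top hC₄ hC₁), ← mul_assoc]; rfl

lemma exists_average_kernelK_rpow_le {R : ℝ} (a b : ℝ) {q : ℝ} (hR0 : 0 < R) (hR1 : R < 1)
    (hq : 0 ≤ q) :
    ∃ C : ENNReal, C ≠ ⊤ ∧ ∀ F : ℂ → ENNReal, ∀ z ∈ disk,
      average R (fun z => (∫⁻ w, ‖kernelK a b z w‖ₑ * F w ∂area) ^ q) z ≤
        C * opK a b F z ^ q := by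
  obtain ⟨C, hC, h⟩ := exists_average_opK_rpow_le a b hR0 hR1 hq
  refine ⟨C, hC, fun F z hz => (average_mono fun u hu => ?_).trans (h F z hz)⟩
  gcongr 1
  refine lintegral_mono_ae ?_
  filter_upwards [ae_mem_disk] with w hw
  rw [Real.enorm_of_nonneg (kernelK_nonneg a b hu.1 hw)]

lemma exists_average_kernelB_rpow_le {R : ℝ} (a b a' b' : ℝ) {q : ℝ} (hR0 : 0 < R) (hR1 : R < 1)
    (hq : 1 ≤ q) :
    ∃ C : ENNReal, C ≠ ⊤ ∧ ∀ F : ℂ → ENNReal, Measurable F → ∀ z ∈ disk,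
      average R (fun z => (∫⁻ w, ‖kernelB a b z w‖ₑ * F w ∂area) ^ q) z ≤
        C * (opK a b F z ^ q + opK a' b' (fun w => F w ^ q) z) := by
  have hq0 : 0 ≤ q := by linarith
  obtain ⟨C₁, hC₁, h₁⟩ := exists_average_opK_rpow_le a b hR0 hR1 hq0
  obtain ⟨C₂, hC₂, h₂⟩ := exists_average_nearKernel_rpow_le a b a' b' hR0 hR1 hq
  set c := ENNReal.ofReal R⁻¹ with hc
  have hcT : c ≠ ⊤ := ENNReal.ofReal_ne_top
  have hcq : c ^ q ≠ ⊤ := ENNReal.rpow_ne_top_of_nonneg hq0 hcT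
  have h2q : (2 : ENNReal) ^ (q - 1) ≠ ⊤ :=
    ENNReal.rpow_ne_top_of_nonneg (by linarith) ENNReal.ofNat_ne_top
  refine ⟨2 ^ (q - 1) * (c ^ q * C₁ + C₂), ENNReal.mul_ne_top h2q
    (ENNReal.add_ne_top.2 ⟨ENNReal.mul_ne_top hcq hC₁, hC₂⟩), fun F hF z hz => ?_⟩
  have hsplit : ∀ u ∈ disk, ∀ w ∈ disk, ‖kernelB a b u w‖ₑ ≤
      c * ENNReal.ofReal (kernelK a b u w) + nearKernel a b R u w := by
    intro u hu w hw
    by_cases huw : w ∈ pseudoDisk R u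
    · rw [nearKernel, Set.indicator_of_mem (by exact huw)]
      exact le_add_self
    · refine le_add_right ?_
      have : R ≤ pseudoDist u w := not_lt.1 fun h => huw ⟨hw, h⟩
      rw [Real.enorm_of_nonneg (kernelB_nonneg a b hu hw), hc, ← ENNReal.ofReal_mul (by positivity)]
      exact ENNReal.ofReal_le_ofReal (kernelB_le_of_le_pseudoDist hR0 hu hw this)
  calc average R (fun z => (∫⁻ w, ‖kernelB a b z w‖ₑ * F w ∂area) ^ q) z
      ≤ average R (fun u => 2 ^ (q - 1) * (c ^ q * opK a b F u ^ q +
          (∫⁻ w, nearKernel a b R u w * F w ∂area) ^ q)) z := by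
        refine average_mono fun u hu => ?_
        calc _ ≤ (c * opK a b F u + ∫⁻ w, nearKernel a b R u w * F w ∂area) ^ q := by
              gcongr 1
              have hm : Measurable fun w => c * (ENNReal.ofReal (kernelK a b u w) * F w) :=
                ((((measurable_kernelK a b).of_uncurry_left (x := u)).ennreal_ofReal).mul
                  hF).const_mul c
              rw [opK, ← lintegral_const_mul' _ _ hcT, ← lintegral_add_left hm]
              refine lintegral_mono_ae ?_
              filter_upwards [ae_mem_disk] with w hw
              rw [← mul_assoc, ← add_mul]
              gcongr
              exact hsplit u hu.1 w hw
          _ ≤ _ := by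
              refine (ENNReal.rpow_add_le_mul_rpow_add_rpow _ _ hq).trans ?_
              rw [ENNReal.mul_rpow_of_nonneg _ _ hq0]
    _ = 2 ^ (q - 1) * (c ^ q * average R (fun u => opK a b F u ^ q) z +
          average R (fun u => (∫⁻ w, nearKernel a b R u w * F w ∂area) ^ q) z) := by
        rw [average_const_mul _ _ _ h2q,
          average_add _ (((measurable_opK a b hF).pow_const q).const_mul _),
          average_const_mul _ _ _ hcq]
    _ ≤ 2 ^ (q - 1) * (c ^ q * (C₁ * opK a b F z ^ q) +
          C₂ * opK a' b' (fun w => F w ^ q) z) := by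
        gcongr
        exacts [h₁ F z hz, h₂ F hF z hz]
    _ ≤ 2 ^ (q - 1) * ((c ^ q * C₁ + C₂) * opK a b F z ^ q +
          (c ^ q * C₁ + C₂) * opK a' b' (fun w => F w ^ q) z) := by
        rw [← mul_assoc]
        gcongr
        exacts [le_self_add, le_add_self]
    _ = _ := by rw [← mul_add, mul_assoc]

end BergmanLocalMeans

theorem mainTheorem7 (R p q a b : ℝ) (hR0 : 0 < R) (hR1 : R < 1)
    (hp0 : 0 < p) (hp1 : p < 1) (hq : 1 ≤ q)
    (ha : -1 / p < a) (hb : 2 / p - 1 / q - 1 < b) (hab : q / p < a + b + 2) :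
    BergmanLocalMeans.DefinesBoundedOperator R p q (BergmanLocalMeans.kernelK a b) ∧
      BergmanLocalMeans.DefinesBoundedOperator R p q (BergmanLocalMeans.kernelB a b) := by
  open BergmanLocalMeans in
  have ha' : -1 < a * p := by rwa [div_lt_iff₀ hp0] at ha
  have hb' : 2 < (b + 2) * p := by
    have h1 : 1 / q ≤ 1 := (div_le_one (by linarith)).2 hq
    have h2 : 2 / p < b + 2 := by linarith
    rwa [div_lt_iff₀ hp0] at h2
  refine ⟨definesBoundedOperator_of_average_le hR0 hR1 hp0 hp1 hq ha' hb'
    (measurable_kernelK a b) ?_, definesBoundedOperator_of_average_le hR0 hR1 hp0 hp1 hq ha' hb'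
    (measurable_kernelB a b) (exists_average_kernelB_rpow_le a b _ _ hR0 hR1 hq)⟩
  obtain ⟨C, hC, h⟩ := exists_average_kernelK_rpow_le a b hR0 hR1 (by linarith : 0 ≤ q)
  refine ⟨C, hC, fun F _ z hz => (h F z hz).trans ?_⟩
  gcongr
  exact le_self_add
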